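/- Let $(\overline M,\overline g)$ be a semi-Riemannian manifold (a smooth manifold with a smooth symmetric nondegenerate $(0,2)$-tensor field of constant index) of constant sectional curvature $c$, with Levi-Civita connection $\overline\nabla$. Let $M$ be an (immersed) lightlike hypersurface of $\overline M$, i.e. a smooth immersed submanifold of codimension one whose induced metric $g$ is degenerate at every point; its radical $\mathrm{Rad}\,TM=TM\cap TM^\perp$ is then a line bundle. A screen distribution is a smooth distribution $S(TM)$ with $TM=\mathrm{Rad}\,TM\oplus S(TM)$. For a nonzero $\xi\in\mathrm{Rad}\,T_uM$ there is a unique $N\in T_u\overline M$ with $\overline g(\xi,N)=1$, $\overline g(N,N)=0$, $N\perp S(T_uM)$; these $N$ span the line bundle $\mathrm{ltr}(TM)$, and $T\overline M|_M=TM\oplus \mathrm{ltr}(TM)$. The induced connection $\nabla$ on $M$ is defined by letting $\nabla_XY$ be the $TM$-component of $\overline\nabla_XY$. Let $R(X,Y)=\nabla_X\nabla_Y-\nabla_Y\nabla_X-\nabla_{[X,Y]}$ be its curvature, $R(X,Y,Z,W)=g(R(X,Y)Z,W)$, and $Ric(X,Y)=\mathrm{tr}(Z\mapsto R(Z,X)Y)$.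 The screen $S(TM)$ is called admissible if $R(\cdot,\cdot,\cdot,\cdot)$ is an algebraic curvature tensor at every point, i.e. $R(x,y,z,w)=-R(y,x,z,w)=R(z,w,x,y)$ and $R(x,y,z,w)+R(y,z,x,w)+R(z,x,y,w)=0$. For a pair $\{\xi,N\}$ as above put $\eta=\overline g(\cdot,N)$ and $\tilde g=g+\eta\otimes\eta$, a nondegenerate form on $T_uM$. For an admissible screen the pseudo-Jacobi operator $J_R(x)$ on $T_uM$ is defined by $\tilde g(J_R(x)y,w)=R(y,x,x,w)$. $M$ is called spacelike (resp. timelike) Osserman at $u$ if for each admissible screen distribution the characteristic polynomial of $J_R(x)$ is the same for all $x\in T_uM$ with $g(x,x)=1$ (resp. $g(x,x)=-1$). $M$ is called Osserman at $u$ if it is spacelike Osserman at $u$ and unit spacelike vectors exist in $T_uM$, or it is timelike Osserman at $u$ and unit timelike vectors exist in $T_uM$, or $T_uM$ has no unit vectors of either kind ($\dim M=1$). $M$ is pointwise Osserman if it is Osserman at each of its points. **Theorem.** If $M$ is pointwise Osserman, then for every admissible screen distribution $S(TM)$ the lightlike hypersurface $(M,g,S(TM))$ is Ricci semi-symmetric: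 $R\cdot Ric=0$, that is, $$(R(V_1,V_2)\cdot Ric)(X,Y)=-Ric(R(V_1,V_2)X,Y)-Ric(X,R(V_1,V_2)Y)=0$$ for all $u\in M$ and $V_1,V_2,X,Y\in T_uM$. -/

import Mathlib

set_option maxSynthPendingDepth 3

open Manifold ContDiff Topology

noncomputable section

namespace LightlikeOsserman

/-! ## Pointwise linear algebra -/

section PointwiseAlgebra

variable {V : Type*} [AddCommGroup V] [Module ℝ V]

/-- `R` is a curvature-like operator on a vector space carrying a (possibly degenerate) symmetric
form `b`. The predicate says that the `(0,4)`-tensor `R(x,y,z,w) = b(R(x,y)z, w)` is an algebraic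
curvature tensor. -/
structure IsAlgebraicCurvature (b : LinearMap.BilinForm ℝ V)
    (R : V →ₗ[ℝ] V →ₗ[ℝ] V →ₗ[ℝ] V) : Prop where
  antisymm : ∀ x y z w, b (R x y z) w = -b (R y x z) w
  pair_symm : ∀ x y z w, b (R x y z) w = b (R z w x) y
  bianchi : ∀ x y z w, b (R x y z) w + b (R y z x) w + b (R z x y) w = 0

/-- The Ricci tensor of `R`: `Ric(X, Y)` is the trace of `Z ↦ R(Z, X)Y`. -/
def ricci (R : V →ₗ[ℝ] V →ₗ[ℝ] V →ₗ[ℝ] V) (X Y : V) : ℝ :=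
  LinearMap.trace ℝ V ((R.flip X).flip Y)

/-- The action of an endomorphism `A` on a `(0,2)`-tensor `T` as a derivation of the tensor
algebra: `(A · T)(X, Y) = -T(AX, Y) - T(X, AY)`. -/
def derivationAction (A : V →ₗ[ℝ] V) (T : V → V → ℝ) (X Y : V) : ℝ :=
  -T (A X) Y - T X (A Y)

/-- `J` is the pseudo-Jacobi operator of `R` with respect to `x`:
`b̃(J y, w) = R(y, x, x, w)`, where `b̃ = b + η ⊗ η` is the form associated with the degenerate
form `b`. -/
def IsPseudoJacobi (b : LinearMap.BilinForm ℝ V) (η : V → ℝ) (R : V →ₗ[ℝ] V →ₗ[ℝ] V →ₗ[ℝ] V)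
    (x : V) (J : V →ₗ[ℝ] V) : Prop :=
  ∀ y w, b (J y) w + η (J y) * η w = b (R y x x) w

/-- The pseudo-sphere `{x | b(x, x) = ε}`; here `ε = 1` (unit spacelike vectors) or `ε = -1`
(unit timelike vectors). -/
def pseudoSphere (b : LinearMap.BilinForm ℝ V) (ε : ℝ) : Set V := {x | b x x = ε}

end PointwiseAlgebra

instance finiteDimensionalTangentSpace {E : Type*} [NormedAddCommGroup E] [NormedSpace ℝ E]
    [FiniteDimensional ℝ E] {M : Type*} [TopologicalSpace M] [ChartedSpace E M] (u : M) :
    FiniteDimensional ℝ (TangentSpace 𝓘(ℝ, E) u) :=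
  inferInstanceAs (FiniteDimensional ℝ E)

section Transversal

variable {V : Type*} [AddCommGroup V] [Module ℝ V] [TopologicalSpace V]
  {W : Type*} [AddCommGroup W] [Module ℝ W] [TopologicalSpace W] [IsTopologicalAddGroup W]
  [ContinuousConstSMul ℝ W]

/-- Let `A : V → W` be the differential of a lightlike hypersurface at a point, `G` the ambient
metric and `S ⊆ V` the screen. `(ξ, N)` is a normalizing pair: `ξ` spans the radical, and `N` is
the null vector orthogonal to the screen with `G(ξ, N) = 1`. -/
structure IsNormalizingPair (G : W →L[ℝ] W →L[ℝ] ℝ) (A : V →L[ℝ] W) (S : Submodule ℝ V)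
    (ξ : V) (N : W) : Prop where
  radical : ∀ v, G (A ξ) (A v) = 0
  pairing : G (A ξ) N = 1
  null : G N N = 0
  orthogonal : ∀ s ∈ S, G (A s) N = 0

/-- The lightlike transversal space `ltr(TM)` at a point, determined by the screen `S`. -/
def lightlikeTransversal (G : W →L[ℝ] W →L[ℝ] ℝ) (A : V →L[ℝ] W) (S : Submodule ℝ V) :
    Submodule ℝ W :=
  Submodule.span ℝ {N | ∃ ξ, IsNormalizingPair G A S ξ N}

open Classical in
/-- The tangential component with respect to the splitting `W = A(V) ⊕ ltr`: the unique linear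
map `T : W → V` with `T ∘ A = id` that vanishes on `ltr`. -/
def tangentialProjection (G : W →L[ℝ] W →L[ℝ] ℝ) (A : V →L[ℝ] W) (S : Submodule ℝ V) :
    W →L[ℝ] V :=
  if h : ∃ T : W →L[ℝ] V, (∀ v, T (A v) = v) ∧ ∀ N ∈ lightlikeTransversal G A S, T N = 0
  then h.choose else 0

end Transversal

/-! ## Linear connections in a coordinate domain -/

section Coordinates

variable {E : Type*} [NormedAddCommGroup E] [NormedSpace ℝ E]
  {E' : Type*} [NormedAddCommGroup E'] [NormedSpace ℝ E']

/-- The curvature `R(a, b)c` at `x` of the connection `∇_a Y = DY(a) + Γ(a, Y)` with Christoffel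
symbols `Γ`, for `R(X,Y) = ∇_X ∇_Y - ∇_Y ∇_X - ∇_[X,Y]`, i.e.
`R(a,b)c = (D_a Γ)(b,c) - (D_b Γ)(a,c) + Γ(a, Γ(b,c)) - Γ(b, Γ(a,c))`. -/
def coordCurvature (Γ : E → E →L[ℝ] E →L[ℝ] E) (x : E) : E →ₗ[ℝ] E →ₗ[ℝ] E →ₗ[ℝ] E :=
  LinearMap.mk₂ ℝ
    (fun a b ↦ ((fderiv ℝ Γ x a b - fderiv ℝ Γ x b a + (Γ x a) ∘L (Γ x b) -
      (Γ x b) ∘L (Γ x a) : E →L[ℝ] E) : E →ₗ[ℝ] E))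
    (fun a a' b ↦ by ext c; simp; abel)
    (fun r a b ↦ by ext c; simp [smul_sub, smul_add])
    (fun a b b' ↦ by ext c; simp; abel)
    (fun r a b ↦ by ext c; simp [smul_sub, smul_add])

theorem coordCurvature_apply (Γ : E → E →L[ℝ] E →L[ℝ] E) (x a b c : E) :
    coordCurvature Γ x a b c =
      fderiv ℝ Γ x a b c - fderiv ℝ Γ x b a c + Γ x a (Γ x b c) - Γ x b (Γ x a c) :=
  rfl

/-- The Christoffel symbols of the first kind of a metric `G`:
`½ (∂_a G(b, c) + ∂_b G(a, c) - ∂_c G(a, b))`, as a linear form in `c`. -/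
def christoffelFirst (G : E → E →L[ℝ] E →L[ℝ] ℝ) (x : E) : E →L[ℝ] E →L[ℝ] E →L[ℝ] ℝ :=
  let D : E →L[ℝ] E →L[ℝ] E →L[ℝ] ℝ := fderiv ℝ G x
  let flip : (E →L[ℝ] E →L[ℝ] ℝ) →L[ℝ] (E →L[ℝ] E →L[ℝ] ℝ) :=
    (ContinuousLinearMap.flipₗᵢ ℝ E E ℝ).toContinuousLinearEquiv.toContinuousLinearMap
  (1 / 2 : ℝ) • (D + D.flip - flip ∘L D.flip)

theorem christoffelFirst_apply (G : E → E →L[ℝ] E →L[ℝ] ℝ) (x a b c : E) :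
    christoffelFirst G x a b c =
      (1 / 2) * (fderiv ℝ G x a b c + fderiv ℝ G x b a c - fderiv ℝ G x c a b) := by
  simp [christoffelFirst]

/-- The Christoffel symbols `Γ(a, b)` of the Levi-Civita connection of a metric `G`: the index of
the symbols of the first kind is raised with the inverse of `G`. -/
def christoffel (G : E → E →L[ℝ] E →L[ℝ] ℝ) (x : E) : E →L[ℝ] E →L[ℝ] E :=
  (ContinuousLinearMap.compL ℝ E (E →L[ℝ] ℝ) E (G x).inverse) ∘L (christoffelFirst G x)

theorem christoffel_apply (G : E → E →L[ℝ] E →L[ℝ] ℝ) (x a b : E) :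
    christoffel G x a b = (G x).inverse (christoffelFirst G x a b) := by
  simp [christoffel]

/-- The ambient derivative `∇̄_a (df(b)) = D²f(a, b) + Γ̄(df(a), df(b))` along a map `f` of
coordinate domains, for a constant field `b`; here `Γ̄` belongs to the Levi-Civita connection of
the ambient metric `G`. -/
def derivAlong (G : E' → E' →L[ℝ] E' →L[ℝ] ℝ) (f : E → E') (x : E) : E →L[ℝ] E →L[ℝ] E' :=
  fderiv ℝ (fderiv ℝ f) x + (christoffel G (f x)).bilinearComp (fderiv ℝ f x) (fderiv ℝ f x)

/-- The Christoffel symbols of the connection induced on a lightlike hypersurface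
`f` by a screen `S`: `Γ(a, b)` is the tangential component of `∇̄_a (df(b))` with respect to
`f^*TM̄ = TM ⊕ ltr(TM)` (Gauss formula). -/
def inducedChristoffel (G : E' → E' →L[ℝ] E' →L[ℝ] ℝ) (f : E → E') (S : E → Submodule ℝ E)
    (x : E) : E →L[ℝ] E →L[ℝ] E :=
  (ContinuousLinearMap.compL ℝ E E' E
    (tangentialProjection (G (f x)) (fderiv ℝ f x) (S x))) ∘L (derivAlong G f x)

theorem inducedChristoffel_apply (G : E' → E' →L[ℝ] E' →L[ℝ] ℝ) (f : E → E')
    (S : E → Submodule ℝ E) (x a b : E) :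
    inducedChristoffel G f S x a b =
      tangentialProjection (G (f x)) (fderiv ℝ f x) (S x)
        (fderiv ℝ (fderiv ℝ f) x a b +
          christoffel G (f x) (fderiv ℝ f x a) (fderiv ℝ f x b)) := by
  simp [inducedChristoffel, derivAlong]

end Coordinates

/-! ## Semi-Riemannian manifolds -/

section Ambient

variable (E' : Type*) [NormedAddCommGroup E'] [NormedSpace ℝ E']
  (M' : Type*) [TopologicalSpace M'] [ChartedSpace E' M'] [IsManifold 𝓘(ℝ, E') ∞ M']

/-- A semi-Riemannian metric: a smooth symmetric nondegenerate `(0,2)`-tensor field of constant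
index. -/
structure SemiRiemannianMetric where
  /-- the scalar product on each tangent space -/
  val : ∀ p : M', TangentSpace 𝓘(ℝ, E') p →L[ℝ] TangentSpace 𝓘(ℝ, E') p →L[ℝ] ℝ
  symm : ∀ p v w, val p v w = val p w v
  nondegenerate : ∀ p v, (∀ w, val p v w = 0) → v = 0
  index_const : ∃ ν : ℕ, ∀ p,
    sigNeg (LinearMap.BilinMap.toQuadraticMap (val p).toLinearMap₁₂) = ν
  contMDiff : ContMDiff 𝓘(ℝ, E') (𝓘(ℝ, E').prod 𝓘(ℝ, E' →L[ℝ] E' →L[ℝ] ℝ)) ∞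
    (fun p ↦ Bundle.TotalSpace.mk' (E' →L[ℝ] E' →L[ℝ] ℝ) p (val p))

end Ambient

section Ambient

variable {E' : Type*} [NormedAddCommGroup E'] [NormedSpace ℝ E']
  {M' : Type*} [TopologicalSpace M'] [ChartedSpace E' M'] [IsManifold 𝓘(ℝ, E') ∞ M']
  (g : SemiRiemannianMetric E' M')

namespace SemiRiemannianMetric

/-- The components of the metric in the preferred chart `ψ` around `p`:
`(v, w) ↦ g(dψ⁻¹ v, dψ⁻¹ w)` at the point with coordinates `y`. -/
def inChart (p : M') (y : E') : E' →L[ℝ] E' →L[ℝ] ℝ :=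
  let dψ : E' →L[ℝ] E' := mfderiv 𝓘(ℝ, E') 𝓘(ℝ, E') (extChartAt 𝓘(ℝ, E') p).symm y
  let G : E' →L[ℝ] E' →L[ℝ] ℝ := g.val ((extChartAt 𝓘(ℝ, E') p).symm y)
  G.bilinearComp dψ dψ

theorem inChart_apply (p : M') (y v w : E') :
    g.inChart p y v w = g.val ((extChartAt 𝓘(ℝ, E') p).symm y)
      (mfderiv 𝓘(ℝ, E') 𝓘(ℝ, E') (extChartAt 𝓘(ℝ, E') p).symm y v)
      (mfderiv 𝓘(ℝ, E') 𝓘(ℝ, E') (extChartAt 𝓘(ℝ, E') p).symm y w) :=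
  rfl

/-- The Riemann curvature of the Levi-Civita connection at `p`, computed in the preferred chart
around `p`. (In Mathlib a tangent vector at `p` is given by its coordinates in that chart.) -/
def curvature (p : M') : TangentSpace 𝓘(ℝ, E') p →ₗ[ℝ] TangentSpace 𝓘(ℝ, E') p →ₗ[ℝ]
    TangentSpace 𝓘(ℝ, E') p →ₗ[ℝ] TangentSpace 𝓘(ℝ, E') p :=
  (coordCurvature (christoffel (g.inChart p)) (extChartAt 𝓘(ℝ, E') p p) :
    E' →ₗ[ℝ] E' →ₗ[ℝ] E' →ₗ[ℝ] E')

/-- The discriminant `g(v,v) g(w,w) - g(v,w)²`; it is nonzero iff `v`, `w` span a nondegenerate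
plane. -/
def planeDiscriminant (p : M') (v w : TangentSpace 𝓘(ℝ, E') p) : ℝ :=
  g.val p v v * g.val p w w - g.val p v w ^ 2

/-- The sectional curvature of the (nondegenerate) plane spanned by `v` and `w`. -/
def sectionalCurvature (p : M') (v w : TangentSpace 𝓘(ℝ, E') p) : ℝ :=
  g.val p (g.curvature p v w w) v / g.planeDiscriminant p v w

/-- All nondegenerate tangent planes have sectional curvature `c`. -/
def HasConstantCurvature (c : ℝ) : Prop :=
  ∀ p (v w : TangentSpace 𝓘(ℝ, E') p), g.planeDiscriminant p v w ≠ 0 →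
    g.sectionalCurvature p v w = c

end SemiRiemannianMetric

end Ambient

/-! ## Lightlike hypersurfaces -/

section Hypersurface

variable {E' : Type*} [NormedAddCommGroup E'] [NormedSpace ℝ E']
  {M' : Type*} [TopologicalSpace M'] [ChartedSpace E' M'] [IsManifold 𝓘(ℝ, E') ∞ M']
  {E : Type*} [NormedAddCommGroup E] [NormedSpace ℝ E]
  {M : Type*} [TopologicalSpace M] [ChartedSpace E M]
  (g : SemiRiemannianMetric E' M') (F : M → M')

/-- The differential of `F : M → M'` at `u`. -/
abbrev differential (u : M) : TangentSpace 𝓘(ℝ, E) u →L[ℝ] TangentSpace 𝓘(ℝ, E') (F u) :=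
  mfderiv 𝓘(ℝ, E) 𝓘(ℝ, E') F u

/-- The induced (degenerate) metric on `T_uM`. -/
def inducedMetric (u : M) : LinearMap.BilinForm ℝ (TangentSpace 𝓘(ℝ, E) u) :=
  (g.val (F u)).toLinearMap₁₂.compl₁₂ (differential F u).toLinearMap (differential F u).toLinearMap

/-- The radical `Rad T_uM = T_uM ∩ T_uM^⊥`. -/
def radical (u : M) : Submodule ℝ (TangentSpace 𝓘(ℝ, E) u) :=
  LinearMap.ker (inducedMetric g F u)

/-- `F : M → M'` is an (immersed) lightlike hypersurface: a smooth immersion of codimension one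
whose induced metric is degenerate at every point. (The radical is then automatically a smooth
distribution of rank one.) -/
structure IsLightlikeHypersurface : Prop where
  contMDiff : ContMDiff 𝓘(ℝ, E) 𝓘(ℝ, E') ∞ F
  injective_differential : ∀ u, Function.Injective (differential (E := E) (E' := E') F u)
  codim : Module.finrank ℝ E' = Module.finrank ℝ E + 1
  degenerate : ∀ u, radical (E := E) g F u ≠ ⊥

/-- A screen distribution: a smooth distribution on `M` complementary to the radical. Smoothness:
every vector of the distribution extends to a local smooth section. -/
structure ScreenDistribution (E : Type*) [NormedAddCommGroup E] [NormedSpace ℝ E]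
    {M : Type*} [TopologicalSpace M] [ChartedSpace E M] [IsManifold 𝓘(ℝ, E) ∞ M]
    (g : SemiRiemannianMetric E' M') (F : M → M') where
  /-- the screen at each point -/
  space : ∀ u : M, Submodule ℝ (TangentSpace 𝓘(ℝ, E) u)
  isCompl : ∀ u, IsCompl (space u) (radical g F u)
  smooth : ∀ u, ∀ v ∈ space u, ∃ X : ∀ y : M, TangentSpace 𝓘(ℝ, E) y, ∃ U ∈ 𝓝 u,
    ContMDiffOn 𝓘(ℝ, E) 𝓘(ℝ, E).tangent ∞ (fun y ↦ (⟨y, X y⟩ : TangentBundle 𝓘(ℝ, E) M)) U ∧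
      (∀ y ∈ U, X y ∈ space y) ∧ X u = v

variable [IsManifold 𝓘(ℝ, E) ∞ M] {g F} (S : ScreenDistribution E g F)

namespace ScreenDistribution

/-- The screen distribution in the preferred chart around `u`. -/
def inChart (u : M) (x : E) : Submodule ℝ E :=
  let dφ : E →L[ℝ] TangentSpace 𝓘(ℝ, E) ((extChartAt 𝓘(ℝ, E) u).symm x) :=
    mfderiv 𝓘(ℝ, E) 𝓘(ℝ, E) (extChartAt 𝓘(ℝ, E) u).symm x
  (S.space ((extChartAt 𝓘(ℝ, E) u).symm x)).comap dφ.toLinearMap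

/-- The Riemann curvature `R` at `u` of the connection induced on the hypersurface by the screen,
computed in the preferred charts around `u` and `F u`. -/
def curvature (u : M) : TangentSpace 𝓘(ℝ, E) u →ₗ[ℝ] TangentSpace 𝓘(ℝ, E) u →ₗ[ℝ]
    TangentSpace 𝓘(ℝ, E) u →ₗ[ℝ] TangentSpace 𝓘(ℝ, E) u :=
  (coordCurvature (inducedChristoffel (g.inChart (F u))
    (writtenInExtChartAt 𝓘(ℝ, E) 𝓘(ℝ, E') u F) (S.inChart u)) (extChartAt 𝓘(ℝ, E) u u) :
      E →ₗ[ℝ] E →ₗ[ℝ] E →ₗ[ℝ] E)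

/-- The screen is admissible: its induced curvature is an algebraic curvature tensor. -/
def IsAdmissible : Prop :=
  ∀ u, IsAlgebraicCurvature (inducedMetric g F u) (S.curvature u)

/-- `M` with the screen is Ricci semi-symmetric: `R(V₁, V₂) · Ric = 0`. -/
def IsRicciSemiSymmetric : Prop :=
  ∀ (u : M) (V₁ V₂ X Y : TangentSpace 𝓘(ℝ, E) u),
    derivationAction (S.curvature u V₁ V₂) (ricci (S.curvature u)) X Y = 0

end ScreenDistribution

variable (g F)

/-- `M` is spacelike (`ε = 1`) or timelike (`ε = -1`) Osserman at `u`: for each admissible screen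
(and each normalizing pair `{ξ, N}` at `u`, with `η = ḡ(·, N)`), the characteristic polynomial of
the pseudo-Jacobi operator `J_R(x)` is independent of `x` in the pseudo-sphere `g(x, x) = ε`. -/
def OssermanOnSphere [FiniteDimensional ℝ E] (ε : ℝ) (u : M) : Prop :=
  ∀ S : ScreenDistribution E g F, S.IsAdmissible →
    ∀ (ξ : TangentSpace 𝓘(ℝ, E) u) (N : TangentSpace 𝓘(ℝ, E') (F u)),
      IsNormalizingPair (g.val (F u)) (differential F u) (S.space u) ξ N →
      ∃ P : Polynomial ℝ, ∀ x ∈ pseudoSphere (inducedMetric g F u) ε,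
        ∀ J : TangentSpace 𝓘(ℝ, E) u →ₗ[ℝ] TangentSpace 𝓘(ℝ, E) u,
          IsPseudoJacobi (inducedMetric g F u) (fun v ↦ g.val (F u) (differential F u v) N)
            (S.curvature u) x J →
          J.charpoly = P

/-- `M` is Osserman at `u`: spacelike Osserman or timelike Osserman there. The two conditions are
equivalent when both pseudo-spheres are nonempty; a condition on an empty pseudo-sphere counts
only if the other one is empty too, which happens just for one-dimensional `M`. -/
def IsOssermanAt [FiniteDimensional ℝ E] (u : M) : Prop :=
  ((pseudoSphere (inducedMetric (E := E) g F u) 1).Nonempty ∧ OssermanOnSphere (E := E) g F 1 u) ∨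
  ((pseudoSphere (inducedMetric (E := E) g F u) (-1)).Nonempty ∧
    OssermanOnSphere (E := E) g F (-1) u) ∨
  (pseudoSphere (inducedMetric (E := E) g F u) 1 = ∅ ∧
    pseudoSphere (inducedMetric (E := E) g F u) (-1) = ∅)

/-- `M` is pointwise Osserman. -/
def IsPointwiseOsserman (E : Type*) [NormedAddCommGroup E] [NormedSpace ℝ E]
    [FiniteDimensional ℝ E] {M : Type*} [TopologicalSpace M] [ChartedSpace E M]
    [IsManifold 𝓘(ℝ, E) ∞ M] (g : SemiRiemannianMetric E' M') (F : M → M') : Prop :=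
  ∀ u : M, IsOssermanAt (E := E) g F u

end Hypersurface

end LightlikeOsserman
end

/-!
Let `ξ`, `N` be a normalizing pair, so that `ξ` spans the radical of `g` and `η = ḡ(·, N)` satisfies
`η(ξ) = 1`. Since `∇̄N` is orthogonal to `N`, the `N`-component of the Gauss equation has no shape
operator term, and constant curvature `c` gives `η(R(ξ, X)Y) = c g(X, Y)`. Taking the trace of
`Z ↦ R(Z, X)X` with respect to `g̃ = g + η ⊗ η` therefore gives `Ric(X, X) = tr J_R(X) + c g(X, X)`.
The Osserman condition makes `tr J_R`, hence `Ric`, constant on the pseudo-sphere, so `Ric = κ g`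
at `u`. Because `R(V₁, V₂)` is skew with respect to `g`, the action of `R` on `κ g` vanishes.
-/

noncomputable section

namespace LightlikeOsserman

section SymmetricForms

variable {V : Type*} [AddCommGroup V] [Module ℝ V] {b Q : LinearMap.BilinForm ℝ V}

theorem exists_smul_mem_pseudoSphere {ε : ℝ} {x : V} (hx : 0 < ε * b x x) :
    ∃ s : ℝ, s ≠ 0 ∧ s • x ∈ pseudoSphere b ε := by
  have hb : b x x ≠ 0 := right_ne_zero_of_mul hx.ne'
  have hpos : 0 < ε / b x x := by
    rw [← mul_div_mul_right _ _ hb]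
    exact div_pos hx (mul_self_pos.2 hb)
  refine ⟨√(ε / b x x), (Real.sqrt_pos.2 hpos).ne', ?_⟩
  simp only [pseudoSphere, Set.mem_ofPred_eq, map_smul, LinearMap.smul_apply, smul_eq_mul]
  rw [← mul_assoc, Real.mul_self_sqrt hpos.le, div_mul_cancel₀ _ hb]

theorem eq_zero_of_pseudoSphere_eq_empty (hb : b.IsSymm) (h₁ : pseudoSphere b 1 = ∅)
    (h₂ : pseudoSphere b (-1) = ∅) : b = 0 := by
  have hle {ε : ℝ} (h : pseudoSphere b ε = ∅) (x : V) : ε * b x x ≤ 0 := by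
    by_contra! hx
    obtain ⟨s, -, hs⟩ := exists_smul_mem_pseudoSphere hx
    exact Set.notMem_empty _ (h ▸ hs)
  refine LinearMap.BilinForm.ext_of_isSymm hb LinearMap.BilinForm.isSymm_zero fun x ↦ ?_
  rw [LinearMap.zero_apply, LinearMap.zero_apply]
  linarith [hle h₁ x, hle h₂ x]

theorem eq_zero_of_apply_self_eq_zero_of_pos (hQ : Q.IsSymm) {x₀ : V} (hx₀ : 0 < b x₀ x₀)
    (h : ∀ x, 0 < b x x → Q x x = 0) : Q = 0 := by
  refine LinearMap.BilinForm.ext_of_isSymm hQ LinearMap.BilinForm.isSymm_zero fun x ↦ ?_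
  -- On the line through `x₀` and `x`, `Q` is analytic and vanishes near `x₀`.
  have hline (B : LinearMap.BilinForm ℝ V) : AnalyticOnNhd ℝ
      (fun t : ℝ ↦ B (x₀ + t • (x - x₀)) (x₀ + t • (x - x₀))) Set.univ := by
    intro t _
    simp only [map_add, map_smul, LinearMap.add_apply, LinearMap.smul_apply, smul_eq_mul]
    fun_prop
  have hpos : ∀ᶠ t : ℝ in 𝓝 0, 0 < b (x₀ + t • (x - x₀)) (x₀ + t • (x - x₀)) :=
    (hline b 0 trivial).continuousAt.eventually_const_lt (by simpa using hx₀)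
  have hzero := (hline Q).eq_of_eventuallyEq analyticOnNhd_const (hpos.mono fun t ht ↦ h _ ht)
  simpa using congrFun hzero 1

theorem eq_smul_of_constant_on_pseudoSphere (hb : b.IsSymm) (hQ : Q.IsSymm) {ε κ : ℝ}
    (hε : ε ≠ 0) (hne : (pseudoSphere b ε).Nonempty) (h : ∀ x ∈ pseudoSphere b ε, Q x x = κ) :
    Q = (κ / ε) • b := by
  obtain ⟨x₀, hx₀ : b x₀ x₀ = ε⟩ := hne
  rw [← sub_eq_zero]
  refine eq_zero_of_apply_self_eq_zero_of_pos (b := ε • b) (hQ.sub (hb.smul _)) (x₀ := x₀)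
    ?_ fun x hx ↦ ?_
  · simpa [hx₀] using hε
  · obtain ⟨s, hs, hmem⟩ := exists_smul_mem_pseudoSphere hx
    have hQs := h _ hmem
    have hbs : b (s • x) (s • x) = ε := hmem
    simp only [map_smul, LinearMap.smul_apply, smul_eq_mul] at hQs hbs
    simp only [LinearMap.sub_apply, LinearMap.smul_apply, smul_eq_mul]
    refine mul_left_cancel₀ (mul_ne_zero hs hs) ?_
    linear_combination hQs - κ / ε * hbs - div_mul_cancel₀ κ hε

end SymmetricForms

section Trace

variable {K : Type*} {V : Type*} [AddCommGroup V]

theorem trace_eq_of_isAdjointPair [Field K] [Module K V] [FiniteDimensional K V]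
    {B : LinearMap.BilinForm K V} (hB : B.Nondegenerate) {f g : V →ₗ[K] V}
    (h : LinearMap.IsAdjointPair B B f g) : LinearMap.trace K V f = LinearMap.trace K V g := by
  have hconj : (B.toDual hB).conj f = Module.Dual.transpose (R := K) g := by
    ext φ w
    obtain ⟨v, rfl⟩ := (B.toDual hB).surjective φ
    rw [LinearEquiv.conj_apply_apply, LinearEquiv.symm_apply_apply, Module.Dual.transpose_apply,
      LinearMap.comp_apply, LinearMap.BilinForm.toDual_def, LinearMap.BilinForm.toDual_def, h]
  rw [← LinearMap.trace_conj' f (B.toDual hB), hconj, LinearMap.trace_transpose']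

theorem trace_eq_neg_nextCoeff_charpoly [CommRing K] [Nontrivial K] [Module K V]
    [Module.Free K V] [Module.Finite K V] (f : V →ₗ[K] V) :
    LinearMap.trace K V f = -f.charpoly.nextCoeff := by
  rw [LinearMap.charpoly_def, ← Matrix.trace_eq_neg_charpoly_nextCoeff,
    LinearMap.trace_eq_matrix_trace K (Module.Free.chooseBasis K V)]

end Trace

section PseudoJacobi

variable {V : Type*} [AddCommGroup V] [Module ℝ V] {b : LinearMap.BilinForm ℝ V}
  {R : V →ₗ[ℝ] V →ₗ[ℝ] V →ₗ[ℝ] V} {η : V →ₗ[ℝ] ℝ} {ξ : V}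

theorem apply_eq_zero_of_ker_eq_span (hξ : LinearMap.ker b = ℝ ∙ ξ) : b ξ = 0 :=
  LinearMap.mem_ker.1 (hξ ▸ Submodule.mem_span_singleton_self ξ)

/-- The form `b̃ = b + η ⊗ η` associated with the degenerate form `b`. -/
def associatedForm (b : LinearMap.BilinForm ℝ V) (η : V →ₗ[ℝ] ℝ) : LinearMap.BilinForm ℝ V :=
  b + LinearMap.BilinForm.linMulLin η η

theorem associatedForm_apply (v w : V) : associatedForm b η v w = b v w + η v * η w := by
  simp [associatedForm]

theorem associatedForm_isSymm (hb : b.IsSymm) : (associatedForm b η).IsSymm :=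
  ⟨fun v w ↦ by rw [associatedForm_apply, associatedForm_apply, hb.eq, mul_comm]⟩

theorem associatedForm_nondegenerate (hb : b.IsSymm) (hξ : LinearMap.ker b = ℝ ∙ ξ)
    (hη : η ξ = 1) : (associatedForm b η).Nondegenerate := by
  have hbξ := apply_eq_zero_of_ker_eq_span hξ
  refine ((associatedForm_isSymm hb).isRefl.nondegenerate_iff_separatingLeft).2 fun v hv ↦ ?_
  have hηv : η v = 0 := by
    simpa [associatedForm_apply, hb.eq v, hbξ, hη] using hv ξ
  have hv_mem : v ∈ LinearMap.ker b :=
    LinearMap.mem_ker.2 (LinearMap.ext fun w ↦ by simpa [associatedForm_apply, hηv] using hv w)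
  obtain ⟨a, rfl⟩ := Submodule.mem_span_singleton.1 (hξ ▸ hv_mem)
  have ha : a = 0 := by simpa [hη] using hηv
  rw [ha, zero_smul]

/-- The polarization of the pseudo-Jacobi operator, `b̃(J y, w) = R(y, X, Y, w)`. It is `R(y, X)Y`
with its component along the radical direction `ξ`, which `b` does not see, removed. -/
def polarPseudoJacobi (η : V →ₗ[ℝ] ℝ) (ξ : V) (R : V →ₗ[ℝ] V →ₗ[ℝ] V →ₗ[ℝ] V) (X Y : V) :
    V →ₗ[ℝ] V :=
  (R.flip X).flip Y - (η ∘ₗ (R.flip X).flip Y).smulRight ξ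

theorem associatedForm_polarPseudoJacobi (hξ : b ξ = 0) (hη : η ξ = 1) (X Y y w : V) :
    associatedForm b η (polarPseudoJacobi η ξ R X Y y) w = b (R y X Y) w := by
  simp [associatedForm_apply, polarPseudoJacobi, hξ, hη]

theorem isPseudoJacobi_polarPseudoJacobi (hξ : b ξ = 0) (hη : η ξ = 1) (x : V) :
    IsPseudoJacobi b η R x (polarPseudoJacobi η ξ R x x) := fun y w ↦ by
  rw [← associatedForm_apply, associatedForm_polarPseudoJacobi hξ hη]

theorem IsAlgebraicCurvature.antisymm_right (hR : IsAlgebraicCurvature b R) (x y z w : V) :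
    b (R x y z) w = -b (R x y w) z := by
  rw [hR.pair_symm, hR.antisymm, hR.pair_symm w z]

theorem IsAlgebraicCurvature.isAdjointPair_polarPseudoJacobi (hR : IsAlgebraicCurvature b R)
    (hb : b.IsSymm) (hξ : b ξ = 0) (hη : η ξ = 1) (X Y : V) :
    LinearMap.IsAdjointPair (associatedForm b η) (associatedForm b η)
      (polarPseudoJacobi η ξ R X Y) (polarPseudoJacobi η ξ R Y X) := fun y w ↦ by
  rw [associatedForm_polarPseudoJacobi hξ hη, (associatedForm_isSymm hb).eq y,
    associatedForm_polarPseudoJacobi hξ hη, hR.pair_symm w, hR.antisymm X,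
    hR.antisymm_right y X w, neg_neg, hR.antisymm_right]

/-- The Ricci tensor as a bilinear form. -/
def ricciForm (R : V →ₗ[ℝ] V →ₗ[ℝ] V →ₗ[ℝ] V) : LinearMap.BilinForm ℝ V :=
  (LinearMap.lflip.toLinearMap ∘ₗ R.flip).compr₂ (LinearMap.trace ℝ V)

theorem ricciForm_apply (X Y : V) : ricciForm R X Y = ricci R X Y := rfl

theorem IsAlgebraicCurvature.derivationAction_eq_zero (hR : IsAlgebraicCurvature b R)
    (hb : b.IsSymm) {T : V → V → ℝ} {κ : ℝ} (hT : ∀ X Y, T X Y = κ * b X Y) (V₁ V₂ X Y : V) :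
    derivationAction (R V₁ V₂) T X Y = 0 := by
  rw [derivationAction, hT, hT, hb.eq X, hR.antisymm_right V₁ V₂ X Y]
  ring

variable [FiniteDimensional ℝ V]

theorem ricci_eq_trace_polarPseudoJacobi (η : V →ₗ[ℝ] ℝ) (ξ X Y : V) :
    ricci R X Y = LinearMap.trace ℝ V (polarPseudoJacobi η ξ R X Y) + η (R ξ X Y) := by
  simp [ricci, polarPseudoJacobi, LinearMap.trace_smulRight]

theorem ricci_eq_zero_of_radical_spans (hξ : ℝ ∙ ξ = ⊤) (hη : η ξ = 1) {X Y : V}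
    (h : η (R ξ X Y) = 0) : ricci R X Y = 0 := by
  have hJ : polarPseudoJacobi η ξ R X Y = 0 := by
    ext y
    obtain ⟨a, ha⟩ := Submodule.mem_span_singleton.1 (hξ ▸ Submodule.mem_top : R y X Y ∈ ℝ ∙ ξ)
    simp [polarPseudoJacobi, ← ha, hη]
  rw [ricci_eq_trace_polarPseudoJacobi η ξ, hJ, map_zero, zero_add, h]

theorem IsAlgebraicCurvature.ricciForm_isSymm (hR : IsAlgebraicCurvature b R) (hb : b.IsSymm)
    (hξ : LinearMap.ker b = ℝ ∙ ξ) (hη : η ξ = 1)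
    (hsymm : ∀ X Y, η (R ξ X Y) = η (R ξ Y X)) : (ricciForm R).IsSymm := by
  have hbξ := apply_eq_zero_of_ker_eq_span hξ
  refine ⟨fun X Y ↦ ?_⟩
  rw [ricciForm_apply, ricciForm_apply, ricci_eq_trace_polarPseudoJacobi η ξ X Y,
    ricci_eq_trace_polarPseudoJacobi η ξ Y X, hsymm, trace_eq_of_isAdjointPair
      (associatedForm_nondegenerate hb hξ hη) (hR.isAdjointPair_polarPseudoJacobi hb hbξ hη X Y)]

theorem IsAlgebraicCurvature.exists_ricci_eq_of_charpoly_constant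
    (hR : IsAlgebraicCurvature b R) (hb : b.IsSymm) (hξ : LinearMap.ker b = ℝ ∙ ξ)
    (hη : η ξ = 1) {c : ℝ} (hc : ∀ X Y, η (R ξ X Y) = c * b X Y) {ε : ℝ} (hε : ε ≠ 0)
    (hne : (pseudoSphere b ε).Nonempty) {P : Polynomial ℝ}
    (hP : ∀ x ∈ pseudoSphere b ε, ∀ J : V →ₗ[ℝ] V, IsPseudoJacobi b η R x J → J.charpoly = P) :
    ∃ κ : ℝ, ∀ X Y, ricci R X Y = κ * b X Y := by
  have hbξ := apply_eq_zero_of_ker_eq_span hξ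
  have hsymm : (ricciForm R).IsSymm :=
    hR.ricciForm_isSymm hb hξ hη fun X Y ↦ by rw [hc, hc, hb.eq]
  have hconst : ∀ x ∈ pseudoSphere b ε, ricciForm R x x = -P.nextCoeff + c * ε := fun x hx ↦ by
    rw [ricciForm_apply, ricci_eq_trace_polarPseudoJacobi η ξ, hc, trace_eq_neg_nextCoeff_charpoly,
      hP x hx _ (isPseudoJacobi_polarPseudoJacobi hbξ hη x), show b x x = ε from hx]
  have hRic := eq_smul_of_constant_on_pseudoSphere hb hsymm hε hne hconst
  exact ⟨_, fun X Y ↦ LinearMap.congr_fun₂ hRic X Y⟩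

end PseudoJacobi

section ConstantCurvature

theorem pair_symm_of_bianchi {V : Type*} {D : V → V → V → V → ℝ}
    (hleft : ∀ x y z w, D x y z w = -D y x z w) (hright : ∀ x y z w, D x y z w = -D x y w z)
    (hbianchi : ∀ x y z w, D x y z w + D y z x w + D z x y w = 0) (x y z w : V) :
    D x y z w = D z w x y := by
  -- The sum of the Bianchi identities over the four faces of an octahedron.
  linarith [hbianchi x y z w, hbianchi y z w x, hbianchi z w x y, hbianchi w x y z, hleft x z y w,
    hleft x z w y, hleft w y z x, hleft w y x z, hleft w x y z, hleft y z x w, hright z x y w,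
    hright x y z w, hright y z w x, hright w y z x, hright z w x y, hright w x y z,
    hright x w y z, hright y w x z]

variable {V : Type*} [AddCommGroup V] [Module ℝ V] {b : LinearMap.BilinForm ℝ V}
  {R R' : V →ₗ[ℝ] V →ₗ[ℝ] V →ₗ[ℝ] V}

namespace IsAlgebraicCurvature

theorem of_antisymm_right (hleft : ∀ x y z w, b (R x y z) w = -b (R y x z) w)
    (hright : ∀ x y z w, b (R x y z) w = -b (R x y w) z)
    (hbianchi : ∀ x y z w, b (R x y z) w + b (R y z x) w + b (R z x y) w = 0) :
    IsAlgebraicCurvature b R :=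
  ⟨hleft, pair_symm_of_bianchi (D := fun x y z w ↦ b (R x y z) w) hleft hright hbianchi, hbianchi⟩

theorem sub (hR : IsAlgebraicCurvature b R) (hR' : IsAlgebraicCurvature b R') :
    IsAlgebraicCurvature b (R - R') where
  antisymm x y z w := by
    simp only [LinearMap.sub_apply, map_sub]
    linarith [hR.antisymm x y z w, hR'.antisymm x y z w]
  pair_symm x y z w := by
    simp only [LinearMap.sub_apply, map_sub]
    linarith [hR.pair_symm x y z w, hR'.pair_symm x y z w]
  bianchi x y z w := by
    simp only [LinearMap.sub_apply, map_sub]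
    linarith [hR.bianchi x y z w, hR'.bianchi x y z w]

theorem eq_zero_of_sectional_eq_zero (hR : IsAlgebraicCurvature b R)
    (h : ∀ x y, b (R x y y) x = 0) (x y z w : V) : b (R x y z) w = 0 := by
  have hxyyw (x y w : V) : b (R x y y) w = 0 := by
    have hxw := h (x + w) y
    simp only [map_add, LinearMap.add_apply, h] at hxw
    have hsymm : b (R w y y) x = b (R x y y) w := by
      rw [hR.pair_symm w y y x, hR.antisymm y x, hR.antisymm_right x y, neg_neg]
    linarith
  have hswap (x y z w : V) : b (R x y z) w = -b (R x z y) w := by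
    have hyz := hxyyw x (y + z) w
    simp only [map_add, LinearMap.add_apply, hxyyw] at hyz
    linarith
  linarith [hR.bianchi x y z w, hswap y z x w, hR.antisymm y x z w, hR.antisymm z x y w,
    hswap x z y w]

end IsAlgebraicCurvature

/-- The curvature operator `R(x, y)z = c (b(y, z) x - b(x, z) y)` of constant sectional
curvature `c`. -/
def constantCurvature (b : LinearMap.BilinForm ℝ V) (c : ℝ) : V →ₗ[ℝ] V →ₗ[ℝ] V →ₗ[ℝ] V :=
  LinearMap.mk₂ ℝ (fun x y ↦ c • ((b y).smulRight x - (b x).smulRight y))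
    (fun x x' y ↦ by ext z; simp [← smul_add]; module)
    (fun r x y ↦ by ext z; simp; module)
    (fun x y y' ↦ by ext z; simp [← smul_add]; module)
    (fun r x y ↦ by ext z; simp; module)

theorem constantCurvature_apply (c : ℝ) (x y z : V) :
    constantCurvature b c x y z = c • (b y z • x - b x z • y) := rfl

theorem form_constantCurvature (c : ℝ) (x y z w : V) :
    b (constantCurvature b c x y z) w = c * (b y z * b x w - b x z * b y w) := by
  simp [constantCurvature_apply]

theorem isAlgebraicCurvature_constantCurvature (hb : b.IsSymm) (c : ℝ) :
    IsAlgebraicCurvature b (constantCurvature b c) where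
  antisymm x y z w := by
    simp only [form_constantCurvature]
    ring
  pair_symm x y z w := by
    simp only [form_constantCurvature]
    rw [hb.eq w x, hb.eq z y, hb.eq z x, hb.eq w y]
    ring
  bianchi x y z w := by
    simp only [form_constantCurvature]
    rw [hb.eq z x, hb.eq z y, hb.eq y x]
    ring

theorem sectional_eq_zero_of_nondegenerate_planes
    (h : ∀ v w, b v v * b w w - b v w ^ 2 ≠ 0 → b (R v w w) v = 0) {v₀ w₀ : V}
    (h₀ : b v₀ v₀ * b w₀ w₀ - b v₀ w₀ ^ 2 ≠ 0) (v w : V) : b (R v w w) v = 0 := by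
  -- Along the line from `(v₀, w₀)` to `(v, w)` the planes are nondegenerate near `(v₀, w₀)`.
  let x (t : ℝ) : V := v₀ + t • (v - v₀)
  let y (t : ℝ) : V := w₀ + t • (w - w₀)
  have hdisc : Continuous fun t : ℝ ↦ b (x t) (x t) * b (y t) (y t) - b (x t) (y t) ^ 2 := by
    simp only [x, y, map_add, map_smul, LinearMap.add_apply, LinearMap.smul_apply, smul_eq_mul]
    fun_prop
  have hsec : AnalyticOnNhd ℝ (fun t : ℝ ↦ b (R (x t) (y t) (y t)) (x t)) Set.univ := by
    intro t _
    simp only [x, y, map_add, map_smul, LinearMap.add_apply, LinearMap.smul_apply, smul_eq_mul]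
    fun_prop
  have hnear : ∀ᶠ t : ℝ in 𝓝 0, b (x t) (x t) * b (y t) (y t) - b (x t) (y t) ^ 2 ≠ 0 :=
    hdisc.continuousAt.eventually_ne (by simpa [x, y] using h₀)
  have hzero := hsec.eq_of_eventuallyEq analyticOnNhd_const (hnear.mono fun t ht ↦ h _ _ ht)
  simpa [x, y] using congrFun hzero 1

theorem IsAlgebraicCurvature.form_eq_of_constant_sectional (hR : IsAlgebraicCurvature b R)
    (hb : b.IsSymm) {c : ℝ} (hc : ∀ v w, b v v * b w w - b v w ^ 2 ≠ 0 →
      b (R v w w) v / (b v v * b w w - b v w ^ 2) = c) {v₀ w₀ : V}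
    (h₀ : b v₀ v₀ * b w₀ w₀ - b v₀ w₀ ^ 2 ≠ 0) (x y z w : V) :
    b (R x y z) w = c * (b y z * b x w - b x z * b y w) := by
  have hdefect : ∀ v w, b v v * b w w - b v w ^ 2 ≠ 0 →
      b ((R - constantCurvature b c) v w w) v = 0 := fun v w hvw ↦ by
    have hcvw := (div_eq_iff hvw).1 (hc v w hvw)
    simp only [LinearMap.sub_apply, map_sub, form_constantCurvature, hcvw, hb.eq w v]
    ring
  have hzero := (hR.sub (isAlgebraicCurvature_constantCurvature hb c)).eq_zero_of_sectional_eq_zero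
    (sectional_eq_zero_of_nondegenerate_planes hdefect h₀) x y z w
  rwa [LinearMap.sub_apply, LinearMap.sub_apply, LinearMap.sub_apply, map_sub,
    LinearMap.sub_apply, form_constantCurvature, sub_eq_zero] at hzero

end ConstantCurvature

section Smoothness

variable {X V₁ V₂ V₃ V₄ W : Type*} [NormedAddCommGroup X] [NormedSpace ℝ X]
  [NormedAddCommGroup V₁] [NormedSpace ℝ V₁] [NormedAddCommGroup V₂] [NormedSpace ℝ V₂]
  [NormedAddCommGroup V₃] [NormedSpace ℝ V₃] [NormedAddCommGroup V₄] [NormedSpace ℝ V₄]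
  [NormedAddCommGroup W] [NormedSpace ℝ W] {n : WithTop ℕ∞} {B : X → V₁ →L[ℝ] V₂ →L[ℝ] W} {x : X}

theorem contDiffAt_flip (hB : ContDiffAt ℝ n B x) : ContDiffAt ℝ n (fun y ↦ (B y).flip) x :=
  (ContinuousLinearMap.flipₗᵢ ℝ V₁ V₂ W).contDiff.contDiffAt.comp x hB

theorem contDiffAt_bilinearComp {C : X → V₃ →L[ℝ] V₁} {D : X → V₄ →L[ℝ] V₂}
    (hB : ContDiffAt ℝ n B x) (hC : ContDiffAt ℝ n C x) (hD : ContDiffAt ℝ n D x) :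
    ContDiffAt ℝ n (fun y ↦ (B y).bilinearComp (C y) (D y)) x :=
  contDiffAt_flip ((contDiffAt_flip (hB.clm_comp hC)).clm_comp hD)

theorem contDiffAt_inverse [CompleteSpace V₁] {A : X → V₁ →L[ℝ] V₂} (hA : ContDiffAt ℝ n A x)
    (hi : (A x).IsInvertible) : ContDiffAt ℝ n (fun y ↦ (A y).inverse) x :=
  ContDiffAt.comp (f := A) (g := ContinuousLinearMap.inverse) x hi.contDiffAt_map_inverse hA

theorem fderiv_clm_apply₂ {v : X → V₁} {w : X → V₂} (hB : DifferentiableAt ℝ B x)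
    (hv : DifferentiableAt ℝ v x) (hw : DifferentiableAt ℝ w x) (a : X) :
    fderiv ℝ (fun y ↦ B y (v y) (w y)) x a =
      fderiv ℝ B x a (v x) (w x) + B x (fderiv ℝ v x a) (w x) + B x (v x) (fderiv ℝ w x a) := by
  rw [fderiv_clm_apply (hB.clm_apply hv) hw, fderiv_clm_apply hB hv]
  simp only [add_apply, ContinuousLinearMap.comp_apply, ContinuousLinearMap.flip_apply]
  abel

theorem fderiv_clm_apply_const₂ (hB : DifferentiableAt ℝ B x) (v : V₁) (w : V₂) (a : X) :
    fderiv ℝ (fun y ↦ B y v w) x a = fderiv ℝ B x a v w := by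
  simp [fderiv_clm_apply₂ hB (differentiableAt_const v) (differentiableAt_const w)]

theorem fderiv_fderiv_symm {f : X → W} (hf : ContDiffAt ℝ 2 f x) (a b : X) :
    fderiv ℝ (fderiv ℝ f) x a b = fderiv ℝ (fderiv ℝ f) x b a :=
  (hf.isSymmSndFDerivAt (by simp)).eq a b

theorem fderiv_fderiv_apply {f : X → W} (hf : ContDiffAt ℝ 2 f x) (a b : X) :
    fderiv ℝ (fun y ↦ fderiv ℝ f y b) x a = fderiv ℝ (fderiv ℝ f) x a b := by
  have hf' : DifferentiableAt ℝ (fderiv ℝ f) x :=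
    (hf.fderiv_right (m := 1) le_rfl).differentiableAt one_ne_zero
  simp [fderiv_clm_apply hf' (differentiableAt_const b)]

end Smoothness

section CovariantDerivative

variable {E E' : Type*} [NormedAddCommGroup E] [NormedSpace ℝ E]
  [NormedAddCommGroup E'] [NormedSpace ℝ E']

/-- The covariant derivative `∇_a W = DW(a) + Γ(Df(a), W)` of a vector field `W` along a map `f`,
for the connection with Christoffel symbols `Γ` on the target of `f`. -/
def covDeriv (Γ : E' → E' →L[ℝ] E' →L[ℝ] E') (f W : E → E') (x a : E) : E' :=
  fderiv ℝ W x a + Γ (f x) (fderiv ℝ f x a) (W x)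

variable {Γ : E' → E' →L[ℝ] E' →L[ℝ] E'} {f W W' : E → E'} {x : E}

theorem covDeriv_id_const (p c a : E') : covDeriv Γ id (fun _ ↦ c) p a = Γ p a c := by
  simp [covDeriv]

theorem covDeriv_congr (h : W =ᶠ[𝓝 x] W') (a : E) : covDeriv Γ f W x a = covDeriv Γ f W' x a := by
  rw [covDeriv, covDeriv, h.fderiv_eq, h.self_of_nhds]

theorem covDeriv_add (hW : DifferentiableAt ℝ W x) (hW' : DifferentiableAt ℝ W' x) (a : E) :
    covDeriv Γ f (fun y ↦ W y + W' y) x a = covDeriv Γ f W x a + covDeriv Γ f W' x a := by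
  rw [covDeriv, fderiv_fun_add hW hW', add_apply, map_add, covDeriv, covDeriv]
  abel

theorem covDeriv_smul {φ : E → ℝ} (hφ : DifferentiableAt ℝ φ x) (hW : DifferentiableAt ℝ W x)
    (a : E) : covDeriv Γ f (fun y ↦ φ y • W y) x a =
      fderiv ℝ φ x a • W x + φ x • covDeriv Γ f W x a := by
  simp only [covDeriv, fderiv_fun_smul hφ hW, add_apply, smul_apply,
    ContinuousLinearMap.smulRight_apply, map_smul, smul_add]
  abel

theorem covDeriv_covDeriv_sub (hΓ : DifferentiableAt ℝ Γ (f x)) (hf : ContDiffAt ℝ 2 f x)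
    (hW : ContDiffAt ℝ 2 W x) (a b : E) :
    covDeriv Γ f (fun y ↦ covDeriv Γ f W y b) x a - covDeriv Γ f (fun y ↦ covDeriv Γ f W y a) x b =
      coordCurvature Γ (f x) (fderiv ℝ f x a) (fderiv ℝ f x b) (W x) := by
  have hdf : DifferentiableAt ℝ f x := hf.differentiableAt two_ne_zero
  have hdW : DifferentiableAt ℝ W x := hW.differentiableAt two_ne_zero
  have hdf' : DifferentiableAt ℝ (fderiv ℝ f) x :=
    (hf.fderiv_right (m := 1) le_rfl).differentiableAt one_ne_zero
  have hdW' : DifferentiableAt ℝ (fderiv ℝ W) x :=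
    (hW.fderiv_right (m := 1) le_rfl).differentiableAt one_ne_zero
  have hΓf : DifferentiableAt ℝ (fun y ↦ Γ (f y)) x := hΓ.comp x hdf
  have hfb (b : E) : DifferentiableAt ℝ (fun y ↦ fderiv ℝ f y b) x := by fun_prop
  have hWb (b : E) : DifferentiableAt ℝ (fun y ↦ fderiv ℝ W y b) x := by fun_prop
  have hiterated (a b : E) : covDeriv Γ f (fun y ↦ covDeriv Γ f W y b) x a =
      fderiv ℝ (fderiv ℝ W) x a b + (fderiv ℝ Γ (f x) (fderiv ℝ f x a) (fderiv ℝ f x b) (W x) +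
        Γ (f x) (fderiv ℝ (fderiv ℝ f) x a b) (W x) + Γ (f x) (fderiv ℝ f x b) (fderiv ℝ W x a)) +
        Γ (f x) (fderiv ℝ f x a) (fderiv ℝ W x b + Γ (f x) (fderiv ℝ f x b) (W x)) := by
    simp only [covDeriv]
    rw [fderiv_fun_add (hWb b) ((hΓf.clm_apply (hfb b)).clm_apply hdW), add_apply,
      fderiv_clm_apply₂ hΓf (hfb b) hdW, fderiv_fderiv_apply hW, fderiv_fderiv_apply hf,
      fderiv_fun_comp x hΓ hdf, ContinuousLinearMap.comp_apply]
  rw [coordCurvature_apply, hiterated, hiterated, fderiv_fderiv_symm hW b a,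
    fderiv_fderiv_symm hf b a, map_add, map_add]
  abel

end CovariantDerivative

section LeviCivita

variable {E E' : Type*} [NormedAddCommGroup E] [NormedSpace ℝ E]
  [NormedAddCommGroup E'] [NormedSpace ℝ E']

theorem isInvertible_of_injective {V W : Type*} [NormedAddCommGroup V] [NormedSpace ℝ V]
    [NormedAddCommGroup W] [NormedSpace ℝ W] [FiniteDimensional ℝ V] [FiniteDimensional ℝ W]
    {A : V →L[ℝ] W} (hA : Function.Injective A)
    (hd : Module.finrank ℝ V = Module.finrank ℝ W) : A.IsInvertible :=
  ⟨(LinearEquiv.ofInjectiveOfFinrankEq A.toLinearMap hA hd).toContinuousLinearEquiv, rfl⟩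

theorem isInvertible_of_nondegenerate [FiniteDimensional ℝ E] {B : E →L[ℝ] E →L[ℝ] ℝ}
    (hB : ∀ v, (∀ w, B v w = 0) → v = 0) : B.IsInvertible := by
  refine isInvertible_of_injective ((injective_iff_map_eq_zero B).2 fun v hv ↦
    hB v (DFunLike.congr_fun hv)) ?_
  rw [← (LinearMap.toContinuousLinearMap (𝕜 := ℝ) (E := E) (F' := ℝ)).finrank_eq]
  exact Subspace.dual_finrank_eq.symm

/-- `G` is the coordinate expression of a smooth semi-Riemannian metric near `p`. -/
structure IsMetricNear (G : E' → E' →L[ℝ] E' →L[ℝ] ℝ) (p : E') : Prop where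
  smooth : ∀ᶠ y in 𝓝 p, ContDiffAt ℝ ∞ G y
  symm : ∀ᶠ y in 𝓝 p, ∀ v w, G y v w = G y w v
  nondegenerate : ∀ᶠ y in 𝓝 p, ∀ v, (∀ w, G y v w = 0) → v = 0

namespace IsMetricNear

variable {G : E' → E' →L[ℝ] E' →L[ℝ] ℝ} {p : E'}

theorem eventually (h : IsMetricNear G p) : ∀ᶠ y in 𝓝 p, IsMetricNear G y := by
  filter_upwards [h.smooth.eventually_nhds, h.symm.eventually_nhds,
    h.nondegenerate.eventually_nhds] with y hsmooth hsymm hnondeg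
  exact ⟨hsmooth, hsymm, hnondeg⟩

theorem contDiffAt (h : IsMetricNear G p) : ContDiffAt ℝ ∞ G p :=
  h.smooth.self_of_nhds

theorem differentiableAt (h : IsMetricNear G p) : DifferentiableAt ℝ G p :=
  h.contDiffAt.differentiableAt (by simp)

theorem apply_comm (h : IsMetricNear G p) (v w : E') : G p v w = G p w v :=
  h.symm.self_of_nhds v w

theorem fderiv_symm (h : IsMetricNear G p) (a b c : E') :
    fderiv ℝ G p a b c = fderiv ℝ G p a c b := by
  have hsymm : (fun y ↦ G y b c) =ᶠ[𝓝 p] fun y ↦ G y c b := h.symm.mono fun y hy ↦ hy b c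
  rw [← fderiv_clm_apply_const₂ h.differentiableAt, hsymm.fderiv_eq,
    fderiv_clm_apply_const₂ h.differentiableAt]

theorem christoffel_symm (h : IsMetricNear G p) (a b : E') :
    christoffel G p a b = christoffel G p b a := by
  rw [christoffel_apply, christoffel_apply]
  congr 1
  ext c
  rw [christoffelFirst_apply, christoffelFirst_apply, h.fderiv_symm c a b]
  ring

theorem contDiffAt_christoffelFirst (h : IsMetricNear G p) :
    ContDiffAt ℝ ∞ (christoffelFirst G) p := by
  have hD : ContDiffAt ℝ ∞ (fderiv ℝ G) p := h.contDiffAt.fderiv_right (by simp)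
  exact ((hD.add (contDiffAt_flip hD)).sub
    (contDiffAt_const.clm_comp (contDiffAt_flip hD))).const_smul (1 / 2 : ℝ)

variable [FiniteDimensional ℝ E']

theorem isInvertible (h : IsMetricNear G p) : (G p).IsInvertible :=
  isInvertible_of_nondegenerate h.nondegenerate.self_of_nhds

theorem contDiffAt_christoffel (h : IsMetricNear G p) : ContDiffAt ℝ ∞ (christoffel G) p := by
  have : CompleteSpace E' := FiniteDimensional.complete ℝ E'
  exact ((ContinuousLinearMap.compL ℝ E' (E' →L[ℝ] ℝ) E').contDiff.contDiffAt.comp p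
    (contDiffAt_inverse h.contDiffAt h.isInvertible)).clm_comp h.contDiffAt_christoffelFirst

theorem differentiableAt_christoffel (h : IsMetricNear G p) :
    DifferentiableAt ℝ (christoffel G) p :=
  h.contDiffAt_christoffel.differentiableAt (by simp)

theorem apply_christoffel (h : IsMetricNear G p) (a b c : E') :
    G p (christoffel G p a b) c = christoffelFirst G p a b c := by
  rw [christoffel_apply, h.isInvertible.self_apply_inverse]

theorem fderiv_eq_christoffel (h : IsMetricNear G p) (a b c : E') :
    fderiv ℝ G p a b c = G p (christoffel G p a b) c + G p b (christoffel G p a c) := by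
  rw [h.apply_comm b, h.apply_christoffel, h.apply_christoffel, christoffelFirst_apply,
    christoffelFirst_apply, h.fderiv_symm a c b, h.fderiv_symm b a c, h.fderiv_symm c a b]
  ring

theorem fderiv_apply_eq_covDeriv {f V W : E → E'} {x : E} (h : IsMetricNear G (f x))
    (hf : DifferentiableAt ℝ f x) (hV : DifferentiableAt ℝ V x) (hW : DifferentiableAt ℝ W x)
    (a : E) : fderiv ℝ (fun y ↦ G (f y) (V y) (W y)) x a =
      G (f x) (covDeriv (christoffel G) f V x a) (W x) +
        G (f x) (V x) (covDeriv (christoffel G) f W x a) := by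
  have hGf : DifferentiableAt ℝ (fun y ↦ G (f y)) x := h.differentiableAt.comp x hf
  rw [fderiv_clm_apply₂ hGf hV hW, fderiv_fun_comp x h.differentiableAt hf,
    ContinuousLinearMap.comp_apply, h.fderiv_eq_christoffel]
  simp only [covDeriv, map_add, add_apply]
  abel

theorem coordCurvature_eq_covDeriv_sub (h : IsMetricNear G p) (a b c : E') :
    coordCurvature (christoffel G) p a b c =
      covDeriv (christoffel G) id (fun y ↦ christoffel G y b c) p a -
        covDeriv (christoffel G) id (fun y ↦ christoffel G y a c) p b := by
  simpa [covDeriv_id_const] using (covDeriv_covDeriv_sub (f := id) (W := fun _ ↦ c)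
    h.differentiableAt_christoffel contDiffAt_id contDiffAt_const a b).symm

theorem coordCurvature_bianchi (h : IsMetricNear G p) (a b c : E') :
    coordCurvature (christoffel G) p a b c + coordCurvature (christoffel G) p b c a +
      coordCurvature (christoffel G) p c a b = 0 := by
  have htorsion (a b c : E') : covDeriv (christoffel G) id (fun y ↦ christoffel G y b c) p a =
      covDeriv (christoffel G) id (fun y ↦ christoffel G y c b) p a :=
    covDeriv_congr (h.eventually.mono fun y hy ↦ hy.christoffel_symm b c) a
  simp only [h.coordCurvature_eq_covDeriv_sub]
  rw [htorsion a b c, htorsion b c a, htorsion c a b]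
  abel

theorem fderiv_fderiv_eq_covDeriv (h : IsMetricNear G p) (a b c d : E') :
    fderiv ℝ (fderiv ℝ (fun y ↦ G y c d)) p a b =
      G p (covDeriv (christoffel G) id (fun y ↦ christoffel G y b c) p a) d +
        G p (christoffel G p b c) (christoffel G p a d) +
        (G p (christoffel G p a c) (christoffel G p b d) +
        G p c (covDeriv (christoffel G) id (fun y ↦ christoffel G y b d) p a)) := by
  have hφ : ContDiffAt ℝ ∞ (fun y ↦ G y c d) p :=
    (h.contDiffAt.clm_apply contDiffAt_const).clm_apply contDiffAt_const
  have hfirst : (fun y ↦ fderiv ℝ (fun y ↦ G y c d) y b) =ᶠ[𝓝 p]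
      fun y ↦ G y (christoffel G y b c) d + G y c (christoffel G y b d) :=
    h.eventually.mono fun y hy ↦ by
      simp only
      rw [fderiv_clm_apply_const₂ hy.differentiableAt, hy.fderiv_eq_christoffel]
  have hG := h.differentiableAt
  have hΓ := h.differentiableAt_christoffel
  have hΓbc (c : E') : DifferentiableAt ℝ (fun y ↦ christoffel G y b c) p := by fun_prop
  have hproduct {V W : E' → E'} (hV : DifferentiableAt ℝ V p) (hW : DifferentiableAt ℝ W p) :
      fderiv ℝ (fun y ↦ G y (V y) (W y)) p a = G p (covDeriv (christoffel G) id V p a) (W p) +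
        G p (V p) (covDeriv (christoffel G) id W p a) :=
    fderiv_apply_eq_covDeriv (f := id) h differentiableAt_id hV hW a
  rw [← fderiv_fderiv_apply (hφ.of_le (by norm_cast)), hfirst.fderiv_eq,
    fderiv_fun_add (by fun_prop) (by fun_prop), add_apply,
    hproduct (hΓbc c) (differentiableAt_const d), hproduct (differentiableAt_const c) (hΓbc d),
    covDeriv_id_const, covDeriv_id_const]

theorem coordCurvature_antisymm_right (h : IsMetricNear G p) (a b c d : E') :
    G p (coordCurvature (christoffel G) p a b c) d =
      -G p (coordCurvature (christoffel G) p a b d) c := by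
  have hφ : ContDiffAt ℝ 2 (fun y ↦ G y c d) p :=
    (h.contDiffAt.clm_apply contDiffAt_const).clm_apply contDiffAt_const |>.of_le
      (by norm_cast)
  have hsymm := fderiv_fderiv_symm hφ a b
  rw [h.fderiv_fderiv_eq_covDeriv, h.fderiv_fderiv_eq_covDeriv] at hsymm
  rw [h.apply_comm _ c, h.coordCurvature_eq_covDeriv_sub, h.coordCurvature_eq_covDeriv_sub]
  simp only [map_sub, sub_apply]
  linarith

theorem isAlgebraicCurvature_coordCurvature (h : IsMetricNear G p) :
    IsAlgebraicCurvature (G p).toLinearMap₁₂ (coordCurvature (christoffel G) p) := by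
  have hleft (a b c : E') : coordCurvature (christoffel G) p a b c =
      -coordCurvature (christoffel G) p b a c := by
    rw [h.coordCurvature_eq_covDeriv_sub, h.coordCurvature_eq_covDeriv_sub, neg_sub]
  refine .of_antisymm_right (fun a b c d ↦ ?_) h.coordCurvature_antisymm_right fun a b c d ↦ ?_
  · rw [hleft, map_neg, LinearMap.neg_apply]
  · rw [← LinearMap.add_apply, ← LinearMap.add_apply, ← map_add, ← map_add,
      h.coordCurvature_bianchi, map_zero, LinearMap.zero_apply]

end IsMetricNear

end LeviCivita

section LightlikeAlgebra

variable {E E' K : Type*} [NormedAddCommGroup E] [NormedSpace ℝ E]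
  [NormedAddCommGroup E'] [NormedSpace ℝ E'] [NormedAddCommGroup K] [NormedSpace ℝ K]

/-- The bilinear form induced on the source of `A` by `G`; for `A` the differential of an immersion
it is the first fundamental form. -/
def inducedForm (G : E' →L[ℝ] E' →L[ℝ] ℝ) (A : E →L[ℝ] E') : LinearMap.BilinForm ℝ E :=
  G.toLinearMap₁₂.compl₁₂ A.toLinearMap A.toLinearMap

theorem mem_ker_inducedForm {G : E' →L[ℝ] E' →L[ℝ] ℝ} {A : E →L[ℝ] E'} {v : E} :
    v ∈ LinearMap.ker (inducedForm G A) ↔ ∀ w, G (A v) (A w) = 0 :=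
  LinearMap.ext_iff

/-- `A` is the differential of a lightlike hypersurface at a point, for the ambient scalar product
`G`, and `S` is a screen. -/
structure IsLightlike (G : E' →L[ℝ] E' →L[ℝ] ℝ) (A : E →L[ℝ] E') (S : Submodule ℝ E) :
    Prop where
  symm : ∀ v w, G v w = G w v
  nondegenerate : ∀ v, (∀ w, G v w = 0) → v = 0
  injective : Function.Injective A
  codim : Module.finrank ℝ E' = Module.finrank ℝ E + 1
  degenerate : LinearMap.ker (inducedForm G A) ≠ ⊥
  isCompl : IsCompl S (LinearMap.ker (inducedForm G A))

/-- The map `(v, t) ↦ A v + t N`, which realizes the splitting `TM ⊕ ltr(TM)`. -/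
def transversalMap (A : E →L[ℝ] E') (N : E') : E × ℝ →L[ℝ] E' :=
  A.coprod (ContinuousLinearMap.toSpanSingleton ℝ N)

theorem transversalMap_apply (A : E →L[ℝ] E') (N : E') (v : E) (t : ℝ) :
    transversalMap A N (v, t) = A v + t • N := by
  simp [transversalMap]

/-- The Gram form of the frame `σ` of a subspace of the hypersurface's tangent space. -/
def gram (G : E' →L[ℝ] E' →L[ℝ] ℝ) (A : E →L[ℝ] E') (σ : K →L[ℝ] E) : K →L[ℝ] K →L[ℝ] ℝ :=
  G.bilinearComp (A ∘L σ) (A ∘L σ)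

/-- The orthogonal projection of the ambient space to the span of the frame `σ`. It is meaningful
only where the Gram form is invertible. -/
def frameProjection (G : E' →L[ℝ] E' →L[ℝ] ℝ) (A : E →L[ℝ] E') (σ : K →L[ℝ] E) : E' →L[ℝ] E :=
  σ ∘L (gram G A σ).inverse ∘L G.bilinearComp (.id ℝ E') (A ∘L σ)

/-- The component of `ξ` orthogonal to the frame `σ`; it spans the radical if `σ` is a frame of a
screen and `ξ` does not lie in that screen. -/
def radicalPart (G : E' →L[ℝ] E' →L[ℝ] ℝ) (A : E →L[ℝ] E') (σ : K →L[ℝ] E) (ξ : E) : E :=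
  ξ - frameProjection G A σ (A ξ)

/-- The component of the ambient vector `N` orthogonal to the frame `σ`. -/
def normalPart (G : E' →L[ℝ] E' →L[ℝ] ℝ) (A : E →L[ℝ] E') (σ : K →L[ℝ] E) (N : E') : E' :=
  N - A (frameProjection G A σ N)

/-- The combination of `radicalPart ξ` and `normalPart N` that is null and pairs to `1` with
`radicalPart ξ`. -/
def nullTransversal (G : E' →L[ℝ] E' →L[ℝ] ℝ) (A : E →L[ℝ] E') (σ : K →L[ℝ] E) (ξ : E)
    (N : E') : E' :=
  let ζ := A (radicalPart G A σ ξ)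
  let W := normalPart G A σ N
  (G ζ W)⁻¹ • (W - (G W W * (2 * G ζ W)⁻¹) • ζ)

variable {G : E' →L[ℝ] E' →L[ℝ] ℝ} {A : E →L[ℝ] E'} {S : Submodule ℝ E} {σ : K →L[ℝ] E}
  {ξ : E} {N : E'}

theorem frameProjection_orthogonal (hi : (gram G A σ).IsInvertible) (w : E') (k : K) :
    G (A (frameProjection G A σ w)) (A (σ k)) = G w (A (σ k)) := by
  have := hi.self_apply_inverse (G.bilinearComp (.id ℝ E') (A ∘L σ) w)
  simpa [gram, frameProjection] using DFunLike.congr_fun this k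

theorem frameProjection_eq_zero {w : E'} (hw : ∀ k, G w (A (σ k)) = 0) :
    frameProjection G A σ w = 0 := by
  have : G.bilinearComp (.id ℝ E') (A ∘L σ) w = 0 := by
    ext k
    simpa using hw k
  rw [frameProjection, ContinuousLinearMap.comp_apply, ContinuousLinearMap.comp_apply, this,
    map_zero, map_zero]

theorem radicalPart_eq_self (hξ : ξ ∈ LinearMap.ker (inducedForm G A)) :
    radicalPart G A σ ξ = ξ := by
  rw [radicalPart, frameProjection_eq_zero fun k ↦ mem_ker_inducedForm.1 hξ _, sub_zero]

theorem normalPart_eq_self (hN : ∀ k, G N (A (σ k)) = 0) : normalPart G A σ N = N := by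
  rw [normalPart, frameProjection_eq_zero hN, map_zero, sub_zero]

theorem IsNormalizingPair.mem_ker (hp : IsNormalizingPair G A S ξ N) :
    ξ ∈ LinearMap.ker (inducedForm G A) :=
  mem_ker_inducedForm.2 hp.radical

namespace IsLightlike

variable (h : IsLightlike G A S)
include h

theorem mem_ker_of_orthogonal {v : E} (hv : ∀ s ∈ S, G (A v) (A s) = 0) :
    v ∈ LinearMap.ker (inducedForm G A) := by
  refine mem_ker_inducedForm.2 fun w ↦ ?_
  obtain ⟨s, r, hs, hr, rfl⟩ := Submodule.codisjoint_iff_exists_add_eq.1 h.isCompl.codisjoint w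
  rw [map_add, map_add, hv s hs, h.symm, mem_ker_inducedForm.1 hr, add_zero]

theorem eq_zero_of_orthogonal {s : E} (hs : s ∈ S) (ho : ∀ s' ∈ S, G (A s) (A s') = 0) : s = 0 :=
  Submodule.disjoint_def.1 h.isCompl.disjoint s hs (h.mem_ker_of_orthogonal ho)

theorem isNormalizingPair_nullTransversal (hi : (gram G A σ).IsInvertible)
    (hσ : LinearMap.range σ.toLinearMap = S)
    (hβ : G (A (radicalPart G A σ ξ)) (normalPart G A σ N) ≠ 0) :
    IsNormalizingPair G A S (radicalPart G A σ ξ) (nullTransversal G A σ ξ N) := by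
  have hframe : ∀ s ∈ S, ∃ k, σ k = s := fun s hs ↦ by rwa [← hσ] at hs
  have hradical : ∀ v, G (A (radicalPart G A σ ξ)) (A v) = 0 := by
    refine mem_ker_inducedForm.1 (h.mem_ker_of_orthogonal fun s hs ↦ ?_)
    obtain ⟨k, rfl⟩ := hframe s hs
    rw [radicalPart, map_sub, map_sub, sub_apply, frameProjection_orthogonal hi, sub_self]
  have hnormal : ∀ s ∈ S, G (A s) (normalPart G A σ N) = 0 := by
    intro s hs
    obtain ⟨k, rfl⟩ := hframe s hs
    rw [h.symm, normalPart, map_sub, sub_apply, frameProjection_orthogonal hi, sub_self]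
  unfold nullTransversal
  set ζ := radicalPart G A σ ξ
  set W := normalPart G A σ N
  refine ⟨hradical, ?_, ?_, fun s hs ↦ ?_⟩
  · simp [hradical, hβ]
  · simp only [map_smul, map_sub, smul_apply, sub_apply, smul_eq_mul, hradical, h.symm W (A ζ)]
    field_simp
    ring
  · simp [hnormal s hs, h.symm (A s) (A ζ), hradical]

theorem isInvertible_gram [FiniteDimensional ℝ E] : (gram G A S.subtypeL).IsInvertible :=
  isInvertible_of_nondegenerate fun v hv ↦
    Subtype.ext (h.eq_zero_of_orthogonal v.2 fun s hs ↦ by simpa [gram] using hv ⟨s, hs⟩)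

theorem exists_isNormalizingPair [FiniteDimensional ℝ E] : ∃ ξ N, IsNormalizingPair G A S ξ N := by
  obtain ⟨ξ, hξ, hξ₀⟩ := Submodule.exists_mem_ne_zero_of_ne_bot h.degenerate
  obtain ⟨N, hN⟩ : ∃ N, G (A ξ) N ≠ 0 := by
    by_contra! hN
    exact hξ₀ ((injective_iff_map_eq_zero A).1 h.injective ξ (h.nondegenerate _ hN))
  refine ⟨_, _, h.isNormalizingPair_nullTransversal (σ := S.subtypeL) (ξ := ξ) (N := N)
    h.isInvertible_gram (by simp) ?_⟩
  rwa [radicalPart_eq_self hξ, normalPart, map_sub, mem_ker_inducedForm.1 hξ, sub_zero]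

variable [FiniteDimensional ℝ E] [FiniteDimensional ℝ E']

theorem isInvertible_transversalMap (hp : IsNormalizingPair G A S ξ N) :
    (transversalMap A N).IsInvertible := by
  refine isInvertible_of_injective ?_ (by simp [h.codim])
  rw [injective_iff_map_eq_zero]
  rintro ⟨v, t⟩ hvt
  rw [transversalMap_apply] at hvt
  have ht : t = 0 := by
    simpa [hp.radical, hp.pairing] using congrArg (G (A ξ)) hvt
  rw [ht, zero_smul, add_zero] at hvt
  rw [ht, (injective_iff_map_eq_zero A).1 h.injective v hvt, Prod.mk_zero_zero]

theorem inverse_transversalMap_apply (hp : IsNormalizingPair G A S ξ N) (v : E) (t : ℝ) :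
    (transversalMap A N).inverse (A v + t • N) = (v, t) := by
  rw [← transversalMap_apply, (h.isInvertible_transversalMap hp).inverse_apply_self]

theorem exists_decomposition (hp : IsNormalizingPair G A S ξ N) (w : E') :
    ∃ (v : E) (t : ℝ), A v + t • N = w := by
  obtain ⟨⟨v, t⟩, rfl⟩ := (h.isInvertible_transversalMap hp).surjective w
  exact ⟨v, t, (transversalMap_apply A N v t).symm⟩

theorem eq_smul_of_mem_ker (hp : IsNormalizingPair G A S ξ N) {r : E}
    (hr : r ∈ LinearMap.ker (inducedForm G A)) : r = G (A r) N • ξ := by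
  rw [← sub_eq_zero]
  refine (injective_iff_map_eq_zero A).1 h.injective _ (h.nondegenerate _ fun w ↦ ?_)
  obtain ⟨v, t, rfl⟩ := h.exists_decomposition hp w
  simp [mem_ker_inducedForm.1 hr, hp.radical, hp.pairing, mul_comm]

theorem ker_eq_span (hp : IsNormalizingPair G A S ξ N) :
    LinearMap.ker (inducedForm G A) = ℝ ∙ ξ := by
  refine le_antisymm (fun r hr ↦ Submodule.mem_span_singleton.2
    ⟨_, (h.eq_smul_of_mem_ker hp hr).symm⟩) ?_
  rw [Submodule.span_singleton_le_iff_mem]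
  exact hp.mem_ker

theorem finrank_screen : Module.finrank ℝ S + 1 = Module.finrank ℝ E := by
  obtain ⟨ξ, N, hp⟩ := h.exists_isNormalizingPair
  have hξ : ξ ≠ 0 := by
    rintro rfl
    simpa using hp.pairing
  rw [← Submodule.finrank_add_eq_of_isCompl h.isCompl, h.ker_eq_span hp, finrank_span_singleton hξ]

theorem exists_eq_smul_of_isNormalizingPair (hp : IsNormalizingPair G A S ξ N) {ξ' : E} {N' : E'}
    (hp' : IsNormalizingPair G A S ξ' N') : ∃ t : ℝ, t • N = N' := by
  obtain ⟨v, t, hN'⟩ := h.exists_decomposition hp N'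
  have hv : v ∈ LinearMap.ker (inducedForm G A) := by
    refine h.mem_ker_of_orthogonal fun s hs ↦ ?_
    simpa [← hN', hp.orthogonal s hs, h.symm (A v)] using hp'.orthogonal s hs
  have ht : t ≠ 0 := by
    rintro rfl
    simpa [← hN', hp'.radical] using hp'.pairing
  have hvN : G (A v) N = 0 := by
    have hnull : t * G (A v) N + t * G (A v) N = 0 := by
      simpa [← hN', mem_ker_inducedForm.1 hv, hp.null, h.symm N] using hp'.null
    exact (mul_eq_zero.1 (by linarith)).resolve_left ht
  refine ⟨t, ?_⟩
  rw [← hN', h.eq_smul_of_mem_ker hp hv, hvN, zero_smul, map_zero, zero_add]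

theorem lightlikeTransversal_eq_span (hp : IsNormalizingPair G A S ξ N) :
    lightlikeTransversal G A S = ℝ ∙ N := by
  refine le_antisymm (Submodule.span_le.2 ?_) (Submodule.span_mono ?_)
  · rintro N' ⟨ξ', hp'⟩
    exact Submodule.mem_span_singleton.2 (h.exists_eq_smul_of_isNormalizingPair hp hp')
  · rintro _ rfl
    exact ⟨ξ, hp⟩

theorem tangentialProjection_eq (hp : IsNormalizingPair G A S ξ N) :
    tangentialProjection G A S = .fst ℝ E ℝ ∘L (transversalMap A N).inverse := by
  have hex : ∃ T : E' →L[ℝ] E, (∀ v, T (A v) = v) ∧ ∀ N ∈ lightlikeTransversal G A S, T N = 0 := by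
    refine ⟨.fst ℝ E ℝ ∘L (transversalMap A N).inverse, fun v ↦ ?_, fun N' hN' ↦ ?_⟩
    · simpa using congrArg Prod.fst (h.inverse_transversalMap_apply hp v 0)
    · rw [h.lightlikeTransversal_eq_span hp] at hN'
      obtain ⟨t, rfl⟩ := Submodule.mem_span_singleton.1 hN'
      simpa using congrArg Prod.fst (h.inverse_transversalMap_apply hp 0 t)
  rw [tangentialProjection, dif_pos hex]
  ext w
  obtain ⟨v, t, rfl⟩ := h.exists_decomposition hp w
  rw [ContinuousLinearMap.comp_apply, h.inverse_transversalMap_apply hp, map_add, map_smul,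
    hex.choose_spec.1, hex.choose_spec.2 N (Submodule.subset_span ⟨ξ, hp⟩), smul_zero, add_zero,
    ContinuousLinearMap.coe_fst']

end IsLightlike

end LightlikeAlgebra

section SmoothFrame

variable {X E E' K : Type*} [NormedAddCommGroup X] [NormedSpace ℝ X]
  [NormedAddCommGroup E] [NormedSpace ℝ E] [NormedAddCommGroup E'] [NormedSpace ℝ E']
  [NormedAddCommGroup K] [NormedSpace ℝ K] {n : WithTop ℕ∞} {G : X → E' →L[ℝ] E' →L[ℝ] ℝ}
  {A : X → E →L[ℝ] E'} {σ : X → K →L[ℝ] E} {S : X → Submodule ℝ E} {x₀ : X}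

theorem contDiffAt_gram (hG : ContDiffAt ℝ n G x₀) (hA : ContDiffAt ℝ n A x₀)
    (hσ : ContDiffAt ℝ n σ x₀) : ContDiffAt ℝ n (fun x ↦ gram (G x) (A x) (σ x)) x₀ :=
  contDiffAt_bilinearComp hG (hA.clm_comp hσ) (hA.clm_comp hσ)

theorem contDiffAt_transversalMap {N : X → E'} (hA : ContDiffAt ℝ n A x₀)
    (hN : ContDiffAt ℝ n N x₀) : ContDiffAt ℝ n (fun x ↦ transversalMap (A x) (N x)) x₀ := by
  have hspan : ContDiffAt ℝ n (fun x ↦ ContinuousLinearMap.toSpanSingleton ℝ (N x)) x₀ :=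
    (ContinuousLinearMap.toSpanSingletonCLE (𝕜 := ℝ) (E := E')).contDiff.contDiffAt.comp x₀ hN
  simp only [transversalMap, ← ContinuousLinearMap.comp_fst_add_comp_snd]
  exact (hA.clm_comp contDiffAt_const).add (hspan.clm_comp contDiffAt_const)

section Complete

variable [CompleteSpace K]

theorem contDiffAt_frameProjection (hG : ContDiffAt ℝ n G x₀) (hA : ContDiffAt ℝ n A x₀)
    (hσ : ContDiffAt ℝ n σ x₀) (hi : (gram (G x₀) (A x₀) (σ x₀)).IsInvertible) :
    ContDiffAt ℝ n (fun x ↦ frameProjection (G x) (A x) (σ x)) x₀ :=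
  hσ.clm_comp ((contDiffAt_inverse (contDiffAt_gram hG hA hσ) hi).clm_comp
    (contDiffAt_bilinearComp hG contDiffAt_const (hA.clm_comp hσ)))

theorem contDiffAt_radicalPart (hG : ContDiffAt ℝ n G x₀) (hA : ContDiffAt ℝ n A x₀)
    (hσ : ContDiffAt ℝ n σ x₀) (hi : (gram (G x₀) (A x₀) (σ x₀)).IsInvertible) (ξ : E) :
    ContDiffAt ℝ n (fun x ↦ radicalPart (G x) (A x) (σ x) ξ) x₀ :=
  contDiffAt_const.sub
    ((contDiffAt_frameProjection hG hA hσ hi).clm_apply (hA.clm_apply contDiffAt_const))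

theorem contDiffAt_normalPart (hG : ContDiffAt ℝ n G x₀) (hA : ContDiffAt ℝ n A x₀)
    (hσ : ContDiffAt ℝ n σ x₀) (hi : (gram (G x₀) (A x₀) (σ x₀)).IsInvertible) (N : E') :
    ContDiffAt ℝ n (fun x ↦ normalPart (G x) (A x) (σ x) N) x₀ :=
  contDiffAt_const.sub
    (hA.clm_apply ((contDiffAt_frameProjection hG hA hσ hi).clm_apply contDiffAt_const))

theorem contDiffAt_nullTransversal (hG : ContDiffAt ℝ n G x₀) (hA : ContDiffAt ℝ n A x₀)
    (hσ : ContDiffAt ℝ n σ x₀) (hi : (gram (G x₀) (A x₀) (σ x₀)).IsInvertible) {ξ : E} {N : E'}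
    (hβ : G x₀ (A x₀ (radicalPart (G x₀) (A x₀) (σ x₀) ξ))
      (normalPart (G x₀) (A x₀) (σ x₀) N) ≠ 0) :
    ContDiffAt ℝ n (fun x ↦ nullTransversal (G x) (A x) (σ x) ξ N) x₀ := by
  have hζ := hA.clm_apply (contDiffAt_radicalPart hG hA hσ hi ξ)
  have hW := contDiffAt_normalPart hG hA hσ hi N
  have hpairing := (hG.clm_apply hζ).clm_apply hW
  exact (hpairing.inv hβ).smul (hW.sub ((((hG.clm_apply hW).clm_apply hW).mul
    ((contDiffAt_const.mul hpairing).inv (mul_ne_zero two_ne_zero hβ))).smul hζ))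

end Complete

variable [FiniteDimensional ℝ E]

theorem exists_contDiffAt_frame
    (hS : ∀ v ∈ S x₀, ∃ Y : X → E, ContDiffAt ℝ n Y x₀ ∧ (∀ᶠ x in 𝓝 x₀, Y x ∈ S x) ∧ Y x₀ = v)
    (hd : ∀ᶠ x in 𝓝 x₀, Module.finrank ℝ (S x) = Module.finrank ℝ (S x₀)) :
    ∃ σ : X → S x₀ →L[ℝ] E, ContDiffAt ℝ n σ x₀ ∧ σ x₀ = (S x₀).subtypeL ∧
      ∀ᶠ x in 𝓝 x₀, LinearMap.range (σ x).toLinearMap = S x := by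
  let e := Module.finBasis ℝ (S x₀)
  choose Y hYsmooth hYmem hYself using fun i ↦ hS (e i) (e i).2
  let σ : X → S x₀ →L[ℝ] E := fun x ↦
    ∑ i, (LinearMap.toContinuousLinearMap (e.coord i)).smulRight (Y i x)
  have hσ_apply (x k) : σ x k = ∑ i, e.repr k i • Y i x := by simp [σ]
  have hσ_self : σ x₀ = (S x₀).subtypeL := by
    ext k
    simpa only [hσ_apply, hYself, map_sum, map_smul, Submodule.subtypeL_apply] using
      congrArg (S x₀).subtypeL (e.sum_repr k)
  have hσ : ContDiffAt ℝ n σ x₀ := .sum fun i _ ↦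
    (ContinuousLinearMap.smulRightL ℝ (S x₀) E
      (LinearMap.toContinuousLinearMap (e.coord i))).contDiff.contDiffAt.comp x₀ (hYsmooth i)
  have hinjective : ∀ᶠ x in 𝓝 x₀, Function.Injective (σ x) :=
    hσ.continuousAt.eventually (ContinuousLinearMap.isOpen_injective.mem_nhds
      (hσ_self ▸ (S x₀).injective_subtype))
  refine ⟨σ, hσ, hσ_self, ?_⟩
  filter_upwards [hinjective, hd, Filter.eventually_all.2 hYmem] with x hσx hdx hYx
  refine Submodule.eq_of_le_of_finrank_eq ?_ ?_
  · rintro _ ⟨k, rfl⟩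
    rw [ContinuousLinearMap.coe_coe, hσ_apply]
    exact Submodule.sum_mem _ fun i _ ↦ Submodule.smul_mem _ _ (hYx i)
  · rw [LinearMap.finrank_range_of_inj hσx, hdx]

theorem exists_contDiffAt_isNormalizingPair [FiniteDimensional ℝ E'] (hG : ContDiffAt ℝ n G x₀)
    (hA : ContDiffAt ℝ n A x₀) (hL : ∀ᶠ x in 𝓝 x₀, IsLightlike (G x) (A x) (S x))
    (hS : ∀ v ∈ S x₀, ∃ Y : X → E, ContDiffAt ℝ n Y x₀ ∧ (∀ᶠ x in 𝓝 x₀, Y x ∈ S x) ∧ Y x₀ = v)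
    {ξ₀ : E} {N₀ : E'} (hp : IsNormalizingPair (G x₀) (A x₀) (S x₀) ξ₀ N₀) :
    ∃ (ξ : X → E) (N : X → E'), ContDiffAt ℝ n N x₀ ∧ N x₀ = N₀ ∧
      ∀ᶠ x in 𝓝 x₀, IsNormalizingPair (G x) (A x) (S x) (ξ x) (N x) := by
  have hL₀ := hL.self_of_nhds
  obtain ⟨σ, hσ, hσ_self, hrange⟩ := exists_contDiffAt_frame hS (hL.mono fun x hx ↦
    Nat.add_right_cancel (hx.finrank_screen.trans hL₀.finrank_screen.symm))
  have hi : (gram (G x₀) (A x₀) (σ x₀)).IsInvertible := by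
    rw [hσ_self]
    exact hL₀.isInvertible_gram
  have : CompleteSpace (S x₀) := FiniteDimensional.complete ℝ _
  have hi_near : ∀ᶠ x in 𝓝 x₀, (gram (G x) (A x) (σ x)).IsInvertible :=
    (contDiffAt_gram hG hA hσ).continuousAt.eventually (ContinuousLinearEquiv.isOpen.mem_nhds hi)
  have hξ : radicalPart (G x₀) (A x₀) (σ x₀) ξ₀ = ξ₀ := radicalPart_eq_self hp.mem_ker
  have hN : normalPart (G x₀) (A x₀) (σ x₀) N₀ = N₀ := by
    refine normalPart_eq_self fun k ↦ ?_
    rw [hL₀.symm, hσ_self]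
    exact hp.orthogonal _ k.2
  have hβ : G x₀ (A x₀ (radicalPart (G x₀) (A x₀) (σ x₀) ξ₀))
      (normalPart (G x₀) (A x₀) (σ x₀) N₀) ≠ 0 := by
    rw [hξ, hN, hp.pairing]
    exact one_ne_zero
  have hβ_near := ((hG.clm_apply (hA.clm_apply (contDiffAt_radicalPart hG hA hσ hi ξ₀))).clm_apply
    (contDiffAt_normalPart hG hA hσ hi N₀)).continuousAt.eventually_ne hβ
  refine ⟨fun x ↦ radicalPart (G x) (A x) (σ x) ξ₀, fun x ↦ nullTransversal (G x) (A x) (σ x) ξ₀ N₀,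
    contDiffAt_nullTransversal hG hA hσ hi hβ, ?_, ?_⟩
  · simp [nullTransversal, hξ, hN, hp.pairing, hp.null]
  · filter_upwards [hi_near, hL, hrange, hβ_near] with x hix hLx hrx hβx
    exact hLx.isNormalizingPair_nullTransversal hix hrx hβx

end SmoothFrame

section Gauss

variable {E E' : Type*} [NormedAddCommGroup E] [NormedSpace ℝ E]
  [NormedAddCommGroup E'] [NormedSpace ℝ E']

/-- The local second fundamental form `B` of a lightlike hypersurface `f`, relative to the
transversal vector `N`: the `N`-component of `∇̄_b (df(c))` in the splitting `TM ⊕ ltr(TM)`. -/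
def secondFundamentalForm (G : E' → E' →L[ℝ] E' →L[ℝ] ℝ) (f : E → E') (N : E') (x : E) :
    E →L[ℝ] E →L[ℝ] ℝ :=
  (ContinuousLinearMap.compL ℝ E E' ℝ
    (.snd ℝ E ℝ ∘L (transversalMap (fderiv ℝ f x) N).inverse)) ∘L derivAlong G f x

variable {G : E' → E' →L[ℝ] E' →L[ℝ] ℝ} {f : E → E'} {S : E → Submodule ℝ E} {x : E}

theorem derivAlong_eq_covDeriv (hf : ContDiffAt ℝ 2 f x) (b c : E) :
    derivAlong G f x b c = covDeriv (christoffel G) f (fun y ↦ fderiv ℝ f y c) x b := by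
  rw [covDeriv, fderiv_fderiv_apply hf]
  rfl

theorem covDeriv_fderiv_apply {Y : E → E} (hf : ContDiffAt ℝ 2 f x) (hY : DifferentiableAt ℝ Y x)
    (a : E) : covDeriv (christoffel G) f (fun y ↦ fderiv ℝ f y (Y y)) x a =
      fderiv ℝ f x (fderiv ℝ Y x a) + derivAlong G f x a (Y x) := by
  have hf' : DifferentiableAt ℝ (fderiv ℝ f) x :=
    (hf.fderiv_right (m := 1) le_rfl).differentiableAt one_ne_zero
  rw [covDeriv, fderiv_clm_apply hf' hY, add_apply, add_assoc]
  rfl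

variable [FiniteDimensional ℝ E']

theorem contDiffAt_derivAlong (hG : IsMetricNear G (f x)) (hf : ContDiffAt ℝ ∞ f x) :
    ContDiffAt ℝ ∞ (derivAlong G f) x := by
  have hf' : ContDiffAt ℝ ∞ (fderiv ℝ f) x := hf.fderiv_right (by simp)
  exact (hf'.fderiv_right (by simp)).add
    (contDiffAt_bilinearComp (hG.contDiffAt_christoffel.comp x hf) hf' hf')

theorem apply_covDeriv_null {N : E → E'} (hG : IsMetricNear G (f x)) (hf : DifferentiableAt ℝ f x)
    (hN : DifferentiableAt ℝ N x) (hnull : ∀ᶠ y in 𝓝 x, G (f y) (N y) (N y) = 0) (a : E) :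
    G (f x) (covDeriv (christoffel G) f N x a) (N x) = 0 := by
  have hconst : (fun y ↦ G (f y) (N y) (N y)) =ᶠ[𝓝 x] fun _ ↦ 0 := hnull
  have hproduct := hG.fderiv_apply_eq_covDeriv hf hN hN a
  rw [hconst.fderiv_eq, fderiv_const_apply, zero_apply, hG.apply_comm (N x)] at hproduct
  linarith

variable [FiniteDimensional ℝ E]

theorem gauss_formula {ξ : E} {N : E'} (h : IsLightlike (G (f x)) (fderiv ℝ f x) (S x))
    (hp : IsNormalizingPair (G (f x)) (fderiv ℝ f x) (S x) ξ N) (b c : E) :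
    derivAlong G f x b c = fderiv ℝ f x (inducedChristoffel G f S x b c) +
      secondFundamentalForm G f N x b c • N := by
  have hsplit := (h.isInvertible_transversalMap hp).self_apply_inverse (derivAlong G f x b c)
  rw [← Prod.mk.eta (p := (transversalMap (fderiv ℝ f x) N).inverse _),
    transversalMap_apply] at hsplit
  rw [inducedChristoffel, h.tangentialProjection_eq hp]
  exact hsplit.symm

section SmoothTransversal

variable {ξ : E → E} {N : E → E'} (hf : ContDiffAt ℝ ∞ f x)
  (hL : ∀ᶠ y in 𝓝 x, IsLightlike (G (f y)) (fderiv ℝ f y) (S y)) (hN : ContDiffAt ℝ ∞ N x)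
  (hp : ∀ᶠ y in 𝓝 x, IsNormalizingPair (G (f y)) (fderiv ℝ f y) (S y) (ξ y) (N y))
include hf hL hN hp

theorem contDiffAt_inverse_transversalMap :
    ContDiffAt ℝ ∞ (fun y ↦ (transversalMap (fderiv ℝ f y) (N y)).inverse) x := by
  have : CompleteSpace E := FiniteDimensional.complete ℝ E
  exact contDiffAt_inverse (contDiffAt_transversalMap (hf.fderiv_right (by simp)) hN)
    (hL.self_of_nhds.isInvertible_transversalMap hp.self_of_nhds)

variable (hG : IsMetricNear G (f x))
include hG

theorem contDiffAt_inducedChristoffel : ContDiffAt ℝ ∞ (inducedChristoffel G f S) x := by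
  have hΓ : inducedChristoffel G f S =ᶠ[𝓝 x] fun y ↦ (ContinuousLinearMap.compL ℝ E E' E
      (.fst ℝ E ℝ ∘L (transversalMap (fderiv ℝ f y) (N y)).inverse)) ∘L derivAlong G f y := by
    filter_upwards [hL, hp] with y hLy hpy
    rw [inducedChristoffel, hLy.tangentialProjection_eq hpy]
  exact (((ContinuousLinearMap.compL ℝ E E' E).contDiff.contDiffAt.comp x (contDiffAt_const.clm_comp
    (contDiffAt_inverse_transversalMap hf hL hN hp))).clm_comp
      (contDiffAt_derivAlong hG hf)).congr_of_eventuallyEq hΓ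

theorem contDiffAt_secondFundamentalForm :
    ContDiffAt ℝ ∞ (fun y ↦ secondFundamentalForm G f (N y) y) x :=
  ((ContinuousLinearMap.compL ℝ E E' ℝ).contDiff.contDiffAt.comp x (contDiffAt_const.clm_comp
    (contDiffAt_inverse_transversalMap hf hL hN hp))).clm_comp (contDiffAt_derivAlong hG hf)

theorem covDeriv_derivAlong (a b c : E) :
    covDeriv (christoffel G) f (fun y ↦ derivAlong G f y b c) x a =
      fderiv ℝ f x (fderiv ℝ (inducedChristoffel G f S) x a b c +
        inducedChristoffel G f S x a (inducedChristoffel G f S x b c)) +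
      (secondFundamentalForm G f (N x) x a (inducedChristoffel G f S x b c) +
        fderiv ℝ (fun y ↦ secondFundamentalForm G f (N y) y b c) x a) • N x +
      secondFundamentalForm G f (N x) x b c • covDeriv (christoffel G) f N x a := by
  have hf₂ : ContDiffAt ℝ 2 f x := hf.of_le (by norm_cast)
  have hdf : DifferentiableAt ℝ (fderiv ℝ f) x :=
    (hf.fderiv_right (m := ∞) (by simp)).differentiableAt (by simp)
  have hdN : DifferentiableAt ℝ N x := hN.differentiableAt (by simp)
  have hdΓ : DifferentiableAt ℝ (inducedChristoffel G f S) x :=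
    (contDiffAt_inducedChristoffel hf hL hN hp hG).differentiableAt (by simp)
  have hdB : DifferentiableAt ℝ (fun y ↦ secondFundamentalForm G f (N y) y) x :=
    (contDiffAt_secondFundamentalForm hf hL hN hp hG).differentiableAt (by simp)
  have hΓbc : DifferentiableAt ℝ (fun y ↦ inducedChristoffel G f S y b c) x := by fun_prop
  have hBbc : DifferentiableAt ℝ (fun y ↦ secondFundamentalForm G f (N y) y b c) x := by fun_prop
  have hgauss : (fun y ↦ derivAlong G f y b c) =ᶠ[𝓝 x] fun y ↦
      fderiv ℝ f y (inducedChristoffel G f S y b c) +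
        secondFundamentalForm G f (N y) y b c • N y := by
    filter_upwards [hL, hp] with y hLy hpy using gauss_formula hLy hpy b c
  rw [covDeriv_congr hgauss, covDeriv_add (hdf.clm_apply hΓbc) (hBbc.fun_smul hdN),
    covDeriv_fderiv_apply hf₂ hΓbc, covDeriv_smul hBbc hdN, fderiv_clm_apply_const₂ hdΓ,
    gauss_formula hL.self_of_nhds hp.self_of_nhds, map_add, add_smul]
  abel

theorem apply_covDeriv_derivAlong (a b c : E) :
    G (f x) (covDeriv (christoffel G) f (fun y ↦ derivAlong G f y b c) x a) (N x) =
      G (f x) (fderiv ℝ f x (fderiv ℝ (inducedChristoffel G f S) x a b c +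
        inducedChristoffel G f S x a (inducedChristoffel G f S x b c))) (N x) := by
  have hweingarten := apply_covDeriv_null hG (hf.differentiableAt (by simp))
    (hN.differentiableAt (by simp)) (hp.mono fun y hy ↦ hy.null) a
  rw [covDeriv_derivAlong hf hL hN hp hG, map_add, map_add, map_smul, map_smul, add_apply,
    add_apply, smul_apply, smul_apply, hp.self_of_nhds.null, hweingarten, smul_zero, smul_zero,
    add_zero, add_zero]

end SmoothTransversal

/-- The `ltr`-component of the Gauss equation: the shape operator terms drop out because
`∇̄N` is orthogonal to the null field `N`. -/
theorem gauss_equation (hG : IsMetricNear G (f x)) (hf : ContDiffAt ℝ ∞ f x)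
    (hL : ∀ᶠ y in 𝓝 x, IsLightlike (G (f y)) (fderiv ℝ f y) (S y))
    (hS : ∀ v ∈ S x, ∃ Y : E → E, ContDiffAt ℝ ∞ Y x ∧ (∀ᶠ y in 𝓝 x, Y y ∈ S y) ∧ Y x = v)
    {ξ₀ : E} {N₀ : E'} (hp₀ : IsNormalizingPair (G (f x)) (fderiv ℝ f x) (S x) ξ₀ N₀)
    (a b c : E) :
    G (f x) (fderiv ℝ f x (coordCurvature (inducedChristoffel G f S) x a b c)) N₀ =
      G (f x) (coordCurvature (christoffel G) (f x) (fderiv ℝ f x a) (fderiv ℝ f x b)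
        (fderiv ℝ f x c)) N₀ := by
  have hdf : ContDiffAt ℝ ∞ (fderiv ℝ f) x := hf.fderiv_right (by simp)
  have hf_near : ∀ᶠ y in 𝓝 x, ContDiffAt ℝ 2 f y :=
    (hf.of_le (m := 2) (by norm_cast)).eventually (by simp)
  obtain ⟨ξ, N, hN, rfl, hp⟩ :=
    exists_contDiffAt_isNormalizingPair (hG.contDiffAt.comp x hf) hdf hL hS hp₀
  have hcovDeriv (a b : E) : covDeriv (christoffel G) f
      (fun y ↦ covDeriv (christoffel G) f (fun y ↦ fderiv ℝ f y c) y b) x a =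
        covDeriv (christoffel G) f (fun y ↦ derivAlong G f y b c) x a :=
    covDeriv_congr (hf_near.mono fun y hy ↦ (derivAlong_eq_covDeriv hy b c).symm) a
  rw [← covDeriv_covDeriv_sub hG.differentiableAt_christoffel hf_near.self_of_nhds
    ((hdf.clm_apply contDiffAt_const).of_le (by norm_cast)), hcovDeriv, hcovDeriv, map_sub,
    sub_apply, apply_covDeriv_derivAlong hf hL hN hp hG, apply_covDeriv_derivAlong hf hL hN hp hG,
    coordCurvature_apply]
  simp only [map_add, map_sub, add_apply, sub_apply]
  ring

end Gauss

section Charts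

variable {E : Type*} [NormedAddCommGroup E] [NormedSpace ℝ E]
  {M : Type*} [TopologicalSpace M] [ChartedSpace E M]

/-- The differential at `x` of the inverse of the preferred chart around `u`. -/
def chartSymmDeriv (u : M) (x : E) : E →L[ℝ] TangentSpace 𝓘(ℝ, E) ((extChartAt 𝓘(ℝ, E) u).symm x) :=
  mfderiv 𝓘(ℝ, E) 𝓘(ℝ, E) (extChartAt 𝓘(ℝ, E) u).symm x

theorem chartSymmDeriv_eq_mfderivWithin (u : M) (x : E) : chartSymmDeriv u x =
    mfderivWithin 𝓘(ℝ, E) 𝓘(ℝ, E) (extChartAt 𝓘(ℝ, E) u).symm (Set.range 𝓘(ℝ, E)) x := by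
  rw [ModelWithCorners.range_eq_univ, mfderivWithin_univ]
  rfl

variable [IsManifold 𝓘(ℝ, E) ∞ M] {u : M} {x : E}

theorem chartSymmDeriv_self (u : M) (v : E) :
    (chartSymmDeriv u (extChartAt 𝓘(ℝ, E) u u) v : E) = v := by
  rw [chartSymmDeriv_eq_mfderivWithin, mfderivWithin_range_extChartAt_symm]
  rfl

theorem isInvertible_chartSymmDeriv (hx : x ∈ (extChartAt 𝓘(ℝ, E) u).target) :
    (chartSymmDeriv u x).IsInvertible := by
  rw [chartSymmDeriv_eq_mfderivWithin]
  exact isInvertible_mfderivWithin_extChartAt_symm hx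

theorem contMDiffAt_extChartAt_symm (hx : x ∈ (extChartAt 𝓘(ℝ, E) u).target) :
    ContMDiffAt 𝓘(ℝ, E) 𝓘(ℝ, E) ∞ (extChartAt 𝓘(ℝ, E) u).symm x :=
  (contMDiffOn_extChartAt_symm u).contMDiffAt ((isOpen_extChartAt_target u).mem_nhds hx)

theorem extChartAt_symm_mem_baseSet (hx : x ∈ (extChartAt 𝓘(ℝ, E) u).target) :
    (extChartAt 𝓘(ℝ, E) u).symm x ∈
      (trivializationAt E (TangentSpace 𝓘(ℝ, E)) u).baseSet := by
  simpa using (extChartAt 𝓘(ℝ, E) u).map_target hx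

theorem trivializationAt_chartSymmDeriv (hx : x ∈ (extChartAt 𝓘(ℝ, E) u).target) (v : E) :
    (trivializationAt E (TangentSpace 𝓘(ℝ, E)) u
      ⟨(extChartAt 𝓘(ℝ, E) u).symm x, chartSymmDeriv u x v⟩).2 = v := by
  have hbase := extChartAt_symm_mem_baseSet hx
  have hcomp := mfderiv_extChartAt_comp_mfderivWithin_extChartAt_symm (I := 𝓘(ℝ, E)) hx
  rw [← TangentBundle.continuousLinearMapAt_trivializationAt (by simpa using hbase),
    ← chartSymmDeriv_eq_mfderivWithin] at hcomp
  exact (Bundle.Trivialization.continuousLinearMapAt_apply_of_mem ℝ _ hbase _).symm.trans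
    (DFunLike.congr_fun hcomp v)

theorem contDiffAt_trivializationAt_section (hx : x ∈ (extChartAt 𝓘(ℝ, E) u).target)
    {X : ∀ y : M, TangentSpace 𝓘(ℝ, E) y}
    (hX : ContMDiffAt 𝓘(ℝ, E) 𝓘(ℝ, E).tangent ∞ (fun y ↦ (⟨y, X y⟩ : TangentBundle 𝓘(ℝ, E) M))
      ((extChartAt 𝓘(ℝ, E) u).symm x)) :
    ContDiffAt ℝ ∞ (fun y ↦ (trivializationAt E (TangentSpace 𝓘(ℝ, E)) u
      ⟨(extChartAt 𝓘(ℝ, E) u).symm y, X ((extChartAt 𝓘(ℝ, E) u).symm y)⟩).2) x :=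
  (((trivializationAt E (TangentSpace 𝓘(ℝ, E)) u).contMDiffAt_section_iff
    (extChartAt_symm_mem_baseSet hx)).1 hX |>.comp x (contMDiffAt_extChartAt_symm hx)).contDiffAt

theorem contMDiffAt_chartSymmDeriv (hx : x ∈ (extChartAt 𝓘(ℝ, E) u).target) (v : E) :
    ContMDiffAt 𝓘(ℝ, E) 𝓘(ℝ, E).tangent ∞ (fun y ↦
      (⟨(extChartAt 𝓘(ℝ, E) u).symm y, chartSymmDeriv u y v⟩ : TangentBundle 𝓘(ℝ, E) M)) x := by
  refine ((trivializationAt E (TangentSpace 𝓘(ℝ, E)) u).contMDiffAt_iff ?_).2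
    ⟨contMDiffAt_extChartAt_symm hx, (contMDiffAt_const (c := v)).congr_of_eventuallyEq ?_⟩
  · exact (Bundle.Trivialization.mem_source _).2 (extChartAt_symm_mem_baseSet hx)
  · filter_upwards [(isOpen_extChartAt_target u).mem_nhds hx] with y hy
      using trivializationAt_chartSymmDeriv hy v

end Charts

section Metric

variable {E' : Type*} [NormedAddCommGroup E'] [NormedSpace ℝ E']
  {M' : Type*} [TopologicalSpace M'] [ChartedSpace E' M'] [IsManifold 𝓘(ℝ, E') ∞ M']
  (g : SemiRiemannianMetric E' M')

namespace SemiRiemannianMetric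

theorem val_congr {p q : M'} (hpq : p = q) {v w : TangentSpace 𝓘(ℝ, E') p}
    {v' w' : TangentSpace 𝓘(ℝ, E') q} (hv : (v : E') = v') (hw : (w : E') = w') :
    g.val p v w = g.val q v' w' := by
  subst hpq
  exact congrArg₂ (fun v w : TangentSpace 𝓘(ℝ, E') p ↦ g.val p v w) hv hw

theorem inChart_apply_chartSymmDeriv (p : M') (y v w : E') :
    g.inChart p y v w = g.val ((extChartAt 𝓘(ℝ, E') p).symm y) (chartSymmDeriv p y v)
      (chartSymmDeriv p y w) :=
  rfl

theorem inChart_self (p : M') : g.inChart p (extChartAt 𝓘(ℝ, E') p p) = g.val p := by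
  ext v w
  exact (g.inChart_apply_chartSymmDeriv p _ v w).trans <|
    g.val_congr (extChartAt_to_inv p) (chartSymmDeriv_self p v) (chartSymmDeriv_self p w)

variable {p : M'} {y : E'}

theorem contDiffAt_inChart_apply (hy : y ∈ (extChartAt 𝓘(ℝ, E') p).target) (v w : E') :
    ContDiffAt ℝ ∞ (fun z ↦ g.inChart p z v w) y := by
  have hsmooth : ContMDiffAt 𝓘(ℝ, E') (𝓘(ℝ, E').prod 𝓘(ℝ)) ∞
      (fun z ↦ Bundle.TotalSpace.mk' ℝ (E := Bundle.Trivial M' ℝ)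
        ((extChartAt 𝓘(ℝ, E') p).symm z) (g.val ((extChartAt 𝓘(ℝ, E') p).symm z)
          (chartSymmDeriv p z v) (chartSymmDeriv p z w))) y :=
    ContMDiffAt.clm_bundle_apply₂ (F₁ := E') (F₂ := E')
      (g.contMDiff.contMDiffAt.comp y (contMDiffAt_extChartAt_symm hy))
      (contMDiffAt_chartSymmDeriv hy v) (contMDiffAt_chartSymmDeriv hy w)
  exact (Bundle.contMDiffAt_totalSpace.1 hsmooth).2.contDiffAt

theorem inChart_nondegenerate (hy : y ∈ (extChartAt 𝓘(ℝ, E') p).target) (v : E')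
    (hv : ∀ w, g.inChart p y v w = 0) : v = 0 := by
  have hψ := isInvertible_chartSymmDeriv hy
  refine hψ.injective ((g.nondegenerate _ _ fun w ↦ ?_).trans (map_zero _).symm)
  obtain ⟨w, rfl⟩ := hψ.surjective w
  exact hv w

theorem isMetricNear_inChart [FiniteDimensional ℝ E']
    (hy : y ∈ (extChartAt 𝓘(ℝ, E') p).target) : IsMetricNear (g.inChart p) y := by
  have hnear : ∀ᶠ z in 𝓝 y, z ∈ (extChartAt 𝓘(ℝ, E') p).target :=
    (isOpen_extChartAt_target p).mem_nhds hy
  refine ⟨hnear.mono fun z hz ↦ ?_, .of_forall fun z v w ↦ g.symm _ _ _,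
    hnear.mono fun z hz ↦ g.inChart_nondegenerate hz⟩
  have hsmooth : ContDiffOn ℝ ∞ (g.inChart p) (extChartAt 𝓘(ℝ, E') p).target :=
    contDiffOn_clm_apply.2 fun v ↦ contDiffOn_clm_apply.2 fun w z hz ↦
      (g.contDiffAt_inChart_apply hz v w).contDiffWithinAt
  exact hsmooth.contDiffAt ((isOpen_extChartAt_target p).mem_nhds hz)

end SemiRiemannianMetric

end Metric

section LocalRepresentation

variable {E : Type*} [NormedAddCommGroup E] [NormedSpace ℝ E]
  {M : Type*} [TopologicalSpace M] [ChartedSpace E M]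
  {E' : Type*} [NormedAddCommGroup E'] [NormedSpace ℝ E']
  {M' : Type*} [TopologicalSpace M'] [ChartedSpace E' M']

variable (E E') in
/-- The coordinate expression of `F` in the preferred charts around `u` and `F u`. -/
abbrev localRep (F : M → M') (u : M) : E → E' :=
  writtenInExtChartAt 𝓘(ℝ, E) 𝓘(ℝ, E') u F

variable (E E') in
/-- The domain of the coordinate expression `localRep E E' F u`; outside of it that function takes
junk values. -/
def localRepDomain (F : M → M') (u : M) : Set E :=
  (extChartAt 𝓘(ℝ, E) u).target ∩ (extChartAt 𝓘(ℝ, E) u).symm ⁻¹'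
    (F ⁻¹' (extChartAt 𝓘(ℝ, E') (F u)).source)

variable {F : M → M'} {u : M} {x : E}

theorem isOpen_localRepDomain (hF : Continuous F) (u : M) : IsOpen (localRepDomain E E' F u) :=
  (continuousOn_extChartAt_symm u).isOpen_inter_preimage (isOpen_extChartAt_target u)
    ((isOpen_extChartAt_source (F u)).preimage hF)

theorem extChartAt_self_mem_localRepDomain (F : M → M') (u : M) :
    extChartAt 𝓘(ℝ, E) u u ∈ localRepDomain E E' F u :=
  ⟨mem_extChartAt_target u, by simp⟩

theorem localRep_mem_target (hx : x ∈ localRepDomain E E' F u) :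
    localRep E E' F u x ∈ (extChartAt 𝓘(ℝ, E') (F u)).target :=
  (extChartAt 𝓘(ℝ, E') (F u)).map_source hx.2

theorem localRep_self (F : M → M') (u : M) :
    localRep E E' F u (extChartAt 𝓘(ℝ, E) u u) = extChartAt 𝓘(ℝ, E') (F u) (F u) := by
  simp [writtenInExtChartAt]

theorem fderiv_localRep_self (hF : MDifferentiableAt 𝓘(ℝ, E) 𝓘(ℝ, E') F u) :
    fderiv ℝ (localRep E E' F u) (extChartAt 𝓘(ℝ, E) u u) = differential F u := by
  rw [differential, hF.mfderiv, ModelWithCorners.range_eq_univ, fderivWithin_univ]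

variable [IsManifold 𝓘(ℝ, E') ∞ M']

theorem inChart_localRep_self (g : SemiRiemannianMetric E' M') (F : M → M') (u : M) :
    g.inChart (F u) (localRep E E' F u (extChartAt 𝓘(ℝ, E) u u)) = g.val (F u) := by
  rw [localRep_self, g.inChart_self]

variable [IsManifold 𝓘(ℝ, E) ∞ M]

theorem contDiffAt_localRep (hF : ContMDiff 𝓘(ℝ, E) 𝓘(ℝ, E') ∞ F)
    (hx : x ∈ localRepDomain E E' F u) : ContDiffAt ℝ ∞ (localRep E E' F u) x :=
  ((contMDiffAt_extChartAt' (by simpa using hx.2)).comp x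
    (hF.contMDiffAt.comp x (contMDiffAt_extChartAt_symm hx.1))).contDiffAt

theorem chartSymmDeriv_fderiv_localRep (hF : ContMDiff 𝓘(ℝ, E) 𝓘(ℝ, E') ∞ F)
    (hx : x ∈ localRepDomain E E' F u) (v : E) :
    (chartSymmDeriv (F u) (localRep E E' F u x) (fderiv ℝ (localRep E E' F u) x v) : E') =
      differential F ((extChartAt 𝓘(ℝ, E) u).symm x) (chartSymmDeriv u x v) := by
  have hrep : MDifferentiableAt 𝓘(ℝ, E) 𝓘(ℝ, E') (localRep E E' F u) x :=
    ((contDiffAt_localRep hF hx).differentiableAt (by simp)).mdifferentiableAt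
  have hcomm : (extChartAt 𝓘(ℝ, E') (F u)).symm ∘ localRep E E' F u =ᶠ[𝓝 x]
      F ∘ (extChartAt 𝓘(ℝ, E) u).symm := by
    filter_upwards [(isOpen_localRepDomain hF.continuous u).mem_nhds hx] with z hz
      using (extChartAt 𝓘(ℝ, E') (F u)).left_inv hz.2
  have hleft := mfderiv_comp_apply x
    ((contMDiffAt_extChartAt_symm (localRep_mem_target hx)).mdifferentiableAt (by simp)) hrep v
  have hright := mfderiv_comp_apply (I' := 𝓘(ℝ, E)) x
    (hF.contMDiffAt.mdifferentiableAt (by simp))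
    ((contMDiffAt_extChartAt_symm hx.1).mdifferentiableAt (by simp)) v
  rw [mfderiv_eq_fderiv] at hleft
  exact hleft.symm.trans ((congrArg (fun A : E →L[ℝ] E' ↦ A v) hcomm.mfderiv_eq).trans hright)

end LocalRepresentation

section LightlikeInCharts

variable {E' : Type*} [NormedAddCommGroup E'] [NormedSpace ℝ E']
  {M' : Type*} [TopologicalSpace M'] [ChartedSpace E' M'] [IsManifold 𝓘(ℝ, E') ∞ M']
  {E : Type*} [NormedAddCommGroup E] [NormedSpace ℝ E]
  {M : Type*} [TopologicalSpace M] [ChartedSpace E M] [IsManifold 𝓘(ℝ, E) ∞ M]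
  {g : SemiRiemannianMetric E' M'} {F : M → M'} {u : M} {x : E}

theorem inducedForm_localRep (hF : ContMDiff 𝓘(ℝ, E) 𝓘(ℝ, E') ∞ F)
    (hx : x ∈ localRepDomain E E' F u) (v w : E) :
    inducedForm (g.inChart (F u) (localRep E E' F u x)) (fderiv ℝ (localRep E E' F u) x) v w =
      inducedMetric g F ((extChartAt 𝓘(ℝ, E) u).symm x) (chartSymmDeriv u x v)
        (chartSymmDeriv u x w) :=
  g.val_congr ((extChartAt 𝓘(ℝ, E') (F u)).left_inv hx.2)
    (chartSymmDeriv_fderiv_localRep hF hx v) (chartSymmDeriv_fderiv_localRep hF hx w)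

theorem ker_inducedForm_localRep (hF : ContMDiff 𝓘(ℝ, E) 𝓘(ℝ, E') ∞ F)
    (hx : x ∈ localRepDomain E E' F u) :
    LinearMap.ker (inducedForm (g.inChart (F u) (localRep E E' F u x))
        (fderiv ℝ (localRep E E' F u) x)) =
      (radical g F ((extChartAt 𝓘(ℝ, E) u).symm x)).comap (chartSymmDeriv u x).toLinearMap := by
  ext v
  rw [Submodule.mem_comap, radical, LinearMap.mem_ker, LinearMap.mem_ker, LinearMap.ext_iff,
    LinearMap.ext_iff]
  simp only [inducedForm_localRep hF hx]
  exact ((isInvertible_chartSymmDeriv hx.1).surjective.forall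
    (p := fun w ↦ inducedMetric g F _ (chartSymmDeriv u x v) w = 0)).symm

theorem injective_fderiv_localRep (hF : ContMDiff 𝓘(ℝ, E) 𝓘(ℝ, E') ∞ F)
    (hx : x ∈ localRepDomain E E' F u)
    (hinj : Function.Injective (differential (E := E) (E' := E') F
      ((extChartAt 𝓘(ℝ, E) u).symm x))) :
    Function.Injective (fderiv ℝ (localRep E E' F u) x) := by
  refine fun v w hvw ↦ (isInvertible_chartSymmDeriv hx.1).injective (hinj ?_)
  exact (chartSymmDeriv_fderiv_localRep hF hx v).symm.trans <|
    (congrArg (fun z : E' ↦ (chartSymmDeriv (F u) (localRep E E' F u x) z : E')) hvw).trans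
      (chartSymmDeriv_fderiv_localRep hF hx w)

theorem isLightlike_localRep (hF : IsLightlikeHypersurface (E := E) g F)
    (S : ScreenDistribution E g F) (hx : x ∈ localRepDomain E E' F u) :
    IsLightlike (g.inChart (F u) (localRep E E' F u x)) (fderiv ℝ (localRep E E' F u) x)
      (S.inChart u x) := by
  let e := LinearEquiv.ofBijective (chartSymmDeriv u x).toLinearMap
    (isInvertible_chartSymmDeriv hx.1).bijective
  have hcomap (P : Submodule ℝ (TangentSpace 𝓘(ℝ, E) ((extChartAt 𝓘(ℝ, E) u).symm x))) :
      P.comap (chartSymmDeriv u x).toLinearMap = (Submodule.orderIsoMapComap e).symm P := rfl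
  have hker := ker_inducedForm_localRep (g := g) hF.contMDiff hx
  have hscreen : S.inChart u x = (S.space ((extChartAt 𝓘(ℝ, E) u).symm x)).comap
      (chartSymmDeriv u x).toLinearMap := rfl
  exact
    { symm := fun _ _ ↦ g.symm _ _ _
      nondegenerate := g.inChart_nondegenerate (localRep_mem_target hx)
      injective := injective_fderiv_localRep hF.contMDiff hx (hF.injective_differential _)
      codim := hF.codim
      degenerate := by
        rw [hker, hcomap, Ne, map_eq_bot_iff]
        exact hF.degenerate _
      isCompl := by
        rw [hker, hscreen, hcomap, hcomap, ← OrderIso.isCompl_iff]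
        exact S.isCompl _ }

namespace ScreenDistribution

variable (S : ScreenDistribution E g F)

theorem mem_space_congr {p q : M} (hpq : p = q) {v : TangentSpace 𝓘(ℝ, E) p}
    {v' : TangentSpace 𝓘(ℝ, E) q} (hv : (v : E) = v') : v ∈ S.space p ↔ v' ∈ S.space q := by
  subst hpq
  exact Eq.to_iff (congrArg (fun v : TangentSpace 𝓘(ℝ, E) p ↦ v ∈ S.space p) hv)

theorem inChart_self (u : M) : S.inChart u (extChartAt 𝓘(ℝ, E) u u) = S.space u :=
  Submodule.ext fun v ↦ S.mem_space_congr (extChartAt_to_inv u) (chartSymmDeriv_self u v)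

theorem exists_contDiffAt_section (u : M) {v : E}
    (hv : v ∈ S.inChart u (extChartAt 𝓘(ℝ, E) u u)) :
    ∃ Y : E → E, ContDiffAt ℝ ∞ Y (extChartAt 𝓘(ℝ, E) u u) ∧
      (∀ᶠ x in 𝓝 (extChartAt 𝓘(ℝ, E) u u), Y x ∈ S.inChart u x) ∧
      Y (extChartAt 𝓘(ℝ, E) u u) = v := by
  rw [S.inChart_self] at hv
  obtain ⟨X, U, hU, hX, hXS, hXu⟩ := S.smooth u v hv
  have hu := mem_extChartAt_target (I := 𝓘(ℝ, E)) u
  have hX_at := hX.contMDiffAt hU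
  rw [← extChartAt_to_inv (I := 𝓘(ℝ, E)) u] at hX_at
  let Y : E → E := fun x ↦ (trivializationAt E (TangentSpace 𝓘(ℝ, E)) u
    ⟨(extChartAt 𝓘(ℝ, E) u).symm x, X ((extChartAt 𝓘(ℝ, E) u).symm x)⟩).2
  have hY {x : E} (hx : x ∈ (extChartAt 𝓘(ℝ, E) u).target) :
      chartSymmDeriv u x (Y x) = X ((extChartAt 𝓘(ℝ, E) u).symm x) := by
    obtain ⟨w, hw⟩ := (isInvertible_chartSymmDeriv hx).surjective
      (X ((extChartAt 𝓘(ℝ, E) u).symm x))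
    have hYw : Y x = w := by
      simp only [Y, ← hw]
      exact trivializationAt_chartSymmDeriv hx w
    rw [hYw, hw]
  refine ⟨Y, contDiffAt_trivializationAt_section hu hX_at, ?_, ?_⟩
  · have hU_pre := (continuousAt_extChartAt_symm (I := 𝓘(ℝ, E)) u).preimage_mem_nhds (t := U)
      (by rwa [extChartAt_to_inv])
    filter_upwards [(isOpen_extChartAt_target u).mem_nhds hu, hU_pre] with x hx hxU
    have hmem := hXS _ hxU
    rw [← hY hx] at hmem
    exact hmem
  · have hXv : ∀ q : M, q = u → (X q : E) = v := by
      rintro q rfl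
      exact hXu
    exact (chartSymmDeriv_self u (Y _)).symm.trans ((hY hu).trans (hXv _ (extChartAt_to_inv u)))

end ScreenDistribution

end LightlikeInCharts

section ConstantCurvature

variable {E' : Type*} [NormedAddCommGroup E'] [NormedSpace ℝ E'] [FiniteDimensional ℝ E']
  {M' : Type*} [TopologicalSpace M'] [ChartedSpace E' M'] [IsManifold 𝓘(ℝ, E') ∞ M']
  (g : SemiRiemannianMetric E' M')

namespace SemiRiemannianMetric

theorem isAlgebraicCurvature_curvature (p : M') :
    IsAlgebraicCurvature (g.val p).toLinearMap₁₂ (g.curvature p) := by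
  have hR := (g.isMetricNear_inChart
    (mem_extChartAt_target (I := 𝓘(ℝ, E')) p)).isAlgebraicCurvature_coordCurvature
  rw [g.inChart_self] at hR
  exact hR

theorem val_curvature_eq_of_sectionalCurvature_eq {p : M'} {c : ℝ}
    (hc : ∀ v w, g.planeDiscriminant p v w ≠ 0 → g.sectionalCurvature p v w = c)
    {v₀ w₀ : TangentSpace 𝓘(ℝ, E') p} (h₀ : g.planeDiscriminant p v₀ w₀ ≠ 0)
    (x y z w : TangentSpace 𝓘(ℝ, E') p) :
    g.val p (g.curvature p x y z) w =
      c * (g.val p y z * g.val p x w - g.val p x z * g.val p y w) :=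
  (g.isAlgebraicCurvature_curvature p).form_eq_of_constant_sectional ⟨g.symm p⟩ hc h₀ x y z w

end SemiRiemannianMetric

end ConstantCurvature

section Hypersurface

variable {E' : Type*} [NormedAddCommGroup E'] [NormedSpace ℝ E']
  {M' : Type*} [TopologicalSpace M'] [ChartedSpace E' M'] [IsManifold 𝓘(ℝ, E') ∞ M']
  {E : Type*} [NormedAddCommGroup E] [NormedSpace ℝ E]
  {M : Type*} [TopologicalSpace M] [ChartedSpace E M]

theorem inducedMetric_isSymm (g : SemiRiemannianMetric E' M') (F : M → M') (u : M) :
    (inducedMetric (E := E) g F u).IsSymm :=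
  ⟨fun _ _ ↦ g.symm _ _ _⟩

variable [IsManifold 𝓘(ℝ, E) ∞ M] {g : SemiRiemannianMetric E' M'} {F : M → M'}
  (S : ScreenDistribution E g F) (u : M)

namespace ScreenDistribution

theorem isLightlike_differential (hF : IsLightlikeHypersurface (E := E) g F) :
    IsLightlike (E := E) (E' := E') (g.val (F u)) (differential F u) (S.space u) := by
  have h := isLightlike_localRep hF S (extChartAt_self_mem_localRepDomain F u)
  rw [inChart_localRep_self, fderiv_localRep_self (hF.contMDiff.mdifferentiable (by simp) u),
    S.inChart_self] at h
  exact h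

variable [FiniteDimensional ℝ E]

theorem exists_isNormalizingPair (hF : IsLightlikeHypersurface (E := E) g F) :
    ∃ ξ N, IsNormalizingPair (g.val (F u)) (differential F u) (S.space u) ξ N :=
  (S.isLightlike_differential u hF).exists_isNormalizingPair

variable [FiniteDimensional ℝ E']
variable {u} {ξ : TangentSpace 𝓘(ℝ, E) u} {N : TangentSpace 𝓘(ℝ, E') (F u)}
  (hp : IsNormalizingPair (g.val (F u)) (differential F u) (S.space u) ξ N)
include hp

theorem ker_inducedMetric_eq_span (hF : IsLightlikeHypersurface (E := E) g F) :
    LinearMap.ker (inducedMetric g F u) = ℝ ∙ ξ :=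
  (S.isLightlike_differential u hF).ker_eq_span hp

theorem val_differential_curvature (hF : IsLightlikeHypersurface (E := E) g F)
    (X Y Z : TangentSpace 𝓘(ℝ, E) u) :
    g.val (F u) (differential F u (S.curvature u X Y Z)) N =
      g.val (F u) (g.curvature (F u) (differential F u X) (differential F u Y)
        (differential F u Z)) N := by
  have hu := extChartAt_self_mem_localRepDomain (E := E) (E' := E') F u
  have hdF := fderiv_localRep_self (hF.contMDiff.mdifferentiable (by simp) u)
  have hnear := (isOpen_localRepDomain hF.contMDiff.continuous u).mem_nhds hu
  have hp_chart : IsNormalizingPair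
      (g.inChart (F u) (localRep E E' F u (extChartAt 𝓘(ℝ, E) u u)))
      (fderiv ℝ (localRep E E' F u) (extChartAt 𝓘(ℝ, E) u u))
      (S.inChart u (extChartAt 𝓘(ℝ, E) u u)) ξ N := by
    rw [inChart_localRep_self, hdF, S.inChart_self]
    exact hp
  have hgauss := gauss_equation (g.isMetricNear_inChart (localRep_mem_target hu))
    (contDiffAt_localRep hF.contMDiff hu)
    (Filter.eventually_of_mem hnear fun x hx ↦ isLightlike_localRep hF S hx)
    (fun v hv ↦ S.exists_contDiffAt_section u hv) hp_chart X Y Z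
  rw [inChart_localRep_self, hdF, localRep_self] at hgauss
  exact hgauss

theorem val_differential_curvature_radical {c : ℝ} (hF : IsLightlikeHypersurface (E := E) g F)
    (hc : ∀ v w, g.planeDiscriminant (F u) v w ≠ 0 → g.sectionalCurvature (F u) v w = c)
    (X Y : TangentSpace 𝓘(ℝ, E) u) :
    g.val (F u) (differential F u (S.curvature u ξ X Y)) N = c * inducedMetric g F u X Y := by
  have hdisc : g.planeDiscriminant (F u) (differential F u ξ) N ≠ 0 := by
    rw [SemiRiemannianMetric.planeDiscriminant, hp.null, hp.pairing]
    norm_num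
  rw [S.val_differential_curvature hp hF, g.val_curvature_eq_of_sectionalCurvature_eq hc hdisc,
    hp.pairing, hp.radical, mul_one, zero_mul, sub_zero]
  rfl

end ScreenDistribution

end Hypersurface

section Osserman

variable {E' : Type*} [NormedAddCommGroup E'] [NormedSpace ℝ E']
  {M' : Type*} [TopologicalSpace M'] [ChartedSpace E' M'] [IsManifold 𝓘(ℝ, E') ∞ M']
  {E : Type*} [NormedAddCommGroup E] [NormedSpace ℝ E] [FiniteDimensional ℝ E]
  {M : Type*} [TopologicalSpace M] [ChartedSpace E M] [IsManifold 𝓘(ℝ, E) ∞ M]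
  {g : SemiRiemannianMetric E' M'} {F : M → M'} (S : ScreenDistribution E g F) {u : M}

namespace ScreenDistribution

/-- The condition of being spacelike (`ε = 1`) or timelike (`ε = -1`) Osserman at `u`, imposed on
the single screen `S`. -/
def OssermanOnSphere (ε : ℝ) (u : M) : Prop :=
  ∀ (ξ : TangentSpace 𝓘(ℝ, E) u) (N : TangentSpace 𝓘(ℝ, E') (F u)),
    IsNormalizingPair (g.val (F u)) (differential F u) (S.space u) ξ N →
    ∃ P : Polynomial ℝ, ∀ x ∈ pseudoSphere (inducedMetric g F u) ε,
      ∀ J : TangentSpace 𝓘(ℝ, E) u →ₗ[ℝ] TangentSpace 𝓘(ℝ, E) u,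
        IsPseudoJacobi (inducedMetric g F u) (fun v ↦ g.val (F u) (differential F u v) N)
          (S.curvature u) x J →
        J.charpoly = P

/-- The condition of being Osserman at `u`, imposed on the single screen `S`. As in
`LightlikeOsserman.IsOssermanAt`, an empty pseudo-sphere counts only if both are empty. -/
def IsOssermanAt (u : M) : Prop :=
  ((pseudoSphere (inducedMetric (E := E) g F u) 1).Nonempty ∧ S.OssermanOnSphere 1 u) ∨
  ((pseudoSphere (inducedMetric (E := E) g F u) (-1)).Nonempty ∧ S.OssermanOnSphere (-1) u) ∨
  (pseudoSphere (inducedMetric (E := E) g F u) 1 = ∅ ∧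
    pseudoSphere (inducedMetric (E := E) g F u) (-1) = ∅)

variable {S}

theorem IsAdmissible.isOssermanAt (hS : S.IsAdmissible)
    (hO : LightlikeOsserman.IsOssermanAt (E := E) g F u) : S.IsOssermanAt u :=
  hO.imp (And.imp_right fun h ↦ h S hS) (Or.imp_left (And.imp_right fun h ↦ h S hS))

variable [FiniteDimensional ℝ E']

theorem IsOssermanAt.exists_ricci_eq (hO : S.IsOssermanAt u) {c : ℝ}
    (hc : ∀ v w, g.planeDiscriminant (F u) v w ≠ 0 → g.sectionalCurvature (F u) v w = c)
    (hF : IsLightlikeHypersurface (E := E) g F)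
    (hR : IsAlgebraicCurvature (inducedMetric g F u) (S.curvature u)) :
    ∃ κ : ℝ, ∀ X Y, ricci (S.curvature u) X Y = κ * inducedMetric g F u X Y := by
  obtain ⟨ξ, N, hp⟩ := S.exists_isNormalizingPair u hF
  let η : TangentSpace 𝓘(ℝ, E) u →ₗ[ℝ] ℝ :=
    (g.val (F u)).toLinearMap₁₂.flip N ∘ₗ (differential F u).toLinearMap
  have hb := inducedMetric_isSymm (E := E) g F u
  have hker : LinearMap.ker (inducedMetric g F u) = ℝ ∙ ξ := S.ker_inducedMetric_eq_span hp hF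
  have hη : η ξ = 1 := hp.pairing
  have hηR (X Y) : η (S.curvature u ξ X Y) = c * inducedMetric g F u X Y :=
    S.val_differential_curvature_radical hp hF hc X Y
  rcases hO with ⟨hne, hsphere⟩ | ⟨hne, hsphere⟩ | ⟨hspacelike, htimelike⟩
  · obtain ⟨P, hP⟩ := hsphere ξ N hp
    exact hR.exists_ricci_eq_of_charpoly_constant hb hker hη hηR one_ne_zero hne hP
  · obtain ⟨P, hP⟩ := hsphere ξ N hp
    exact hR.exists_ricci_eq_of_charpoly_constant hb hker hη hηR (by norm_num) hne hP
  · have hb₀ := eq_zero_of_pseudoSphere_eq_empty hb hspacelike htimelike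
    rw [hb₀, LinearMap.ker_zero] at hker
    refine ⟨0, fun X Y ↦ ?_⟩
    rw [zero_mul, ricci_eq_zero_of_radical_spans hker.symm hη]
    rw [hηR, hb₀, LinearMap.zero_apply, LinearMap.zero_apply, mul_zero]

end ScreenDistribution

end Osserman

end LightlikeOsserman

end

theorem theorem5p5_general
    {E' : Type*} [NormedAddCommGroup E'] [NormedSpace ℝ E'] [FiniteDimensional ℝ E']
    {M' : Type*} [TopologicalSpace M'] [ChartedSpace E' M'] [IsManifold 𝓘(ℝ, E') ∞ M']
    {E : Type*} [NormedAddCommGroup E] [NormedSpace ℝ E] [FiniteDimensional ℝ E]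
    {M : Type*} [TopologicalSpace M] [ChartedSpace E M] [IsManifold 𝓘(ℝ, E) ∞ M]
    {g : LightlikeOsserman.SemiRiemannianMetric E' M'} {F : M → M'}
    (hF : LightlikeOsserman.IsLightlikeHypersurface (E := E) g F)
    {S : LightlikeOsserman.ScreenDistribution E g F} {u : M} {c : ℝ}
    (hc : ∀ v w, g.planeDiscriminant (F u) v w ≠ 0 → g.sectionalCurvature (F u) v w = c)
    (hR : LightlikeOsserman.IsAlgebraicCurvature (LightlikeOsserman.inducedMetric g F u)
      (S.curvature u))
    (hO : S.IsOssermanAt u) (V₁ V₂ X Y : TangentSpace 𝓘(ℝ, E) u) :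
    LightlikeOsserman.derivationAction (S.curvature u V₁ V₂)
      (LightlikeOsserman.ricci (S.curvature u)) X Y = 0 := by
  obtain ⟨κ, hκ⟩ := hO.exists_ricci_eq hc hF hR
  exact hR.derivationAction_eq_zero (LightlikeOsserman.inducedMetric_isSymm g F u) hκ V₁ V₂ X Y

theorem theorem5p5
    {E' : Type*} [NormedAddCommGroup E'] [NormedSpace ℝ E'] [FiniteDimensional ℝ E']
    {M' : Type*} [TopologicalSpace M'] [ChartedSpace E' M'] [IsManifold 𝓘(ℝ, E') ∞ M']
    {E : Type*} [NormedAddCommGroup E] [NormedSpace ℝ E] [FiniteDimensional ℝ E]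
    {M : Type*} [TopologicalSpace M] [ChartedSpace E M] [IsManifold 𝓘(ℝ, E) ∞ M]
    (g : LightlikeOsserman.SemiRiemannianMetric E' M') (c : ℝ) (hc : g.HasConstantCurvature c)
    (F : M → M') (hF : LightlikeOsserman.IsLightlikeHypersurface (E := E) g F)
    (hO : LightlikeOsserman.IsPointwiseOsserman E g F)
    (S : LightlikeOsserman.ScreenDistribution E g F) (hS : S.IsAdmissible) :
    S.IsRicciSemiSymmetric := fun u ↦
  theorem5p5_general hF (hc (F u)) (hS u) (hS.isOssermanAt (hO u))
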